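/- Theorem (Characterization of Weyl points). Let $M$ be a smooth manifold of dimension 3, let $\mathrm{Herm}(n)$ be the real vector space of Hermitian $n\times n$ matrices with the Frobenius norm, and denote by $\lambda_1\le\dots\le\lambda_n$ the ordered eigenvalues of such a matrix. Let $\Sigma_2\subset\mathrm{Herm}(n)$ ($n\ge 2$) be the submanifold of matrices with $\lambda_1=\lambda_2$ and $\lambda_2<\lambda_j$ for all $j\ge 3$. Let $H\colon M\to\mathrm{Herm}(n)$ be a $C^\infty$ map and let $p_0\in M$ be a twofold ground-state degeneracy point, that is, $H_0:=H(p_0)\in\Sigma_2$. The effective map germ $h\colon(\mathbb R^3,0)\to(\mathbb R^3,0)$ is defined as follows. Choose a unitary matrix $U_0$ such that $D_0=U_0^{-1}H_0U_0$ is diagonal with increasing diagonal entries, and a smooth chart $\varphi$ of $M$ with $\varphi(p_0)=0$. Every Hermitian matrix $A$ near $D_0$ has a unique Schrieffer–Wolff decomposition $$A=e^{iS}\,(D_0+B+T+H_{\mathrm{eff}})\,e^{-iS}$$ with Hermitian $S,B,T,H_{\mathrm{eff}}$ close to $0$, where $S$ vanishes on the upper left $2\times2$ and lower right $(n-2)\times(n-2)$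 diagonal blocks, $B$ is supported in the lower right $(n-2)\times(n-2)$ block, $T$ is a scalar matrix in the upper left $2\times2$ block and zero elsewhere, $H_{\mathrm{eff}}$ is supported in the upper left $2\times 2$ block and traceless, and the first two columns of $e^{iS}$ span the sum of the eigenspaces of $A$ of its two lowest eigenvalues. For $x$ near $0$, let $h(x)=(y_1,y_2,y_3)$ be the coordinates of the matrix $H_{\mathrm{eff}}=\tfrac1{\sqrt2}(y_1\sigma_x+y_2\sigma_y+y_3\sigma_z)$ belonging to $A=U_0^{-1}H(\varphi^{-1}(x))U_0$. For every choice of $U_0$ and $\varphi$, $h$ is smooth at $0$ with $h(0)=0$, and the following are equivalent: 1. $H$ is transverse to $\Sigma_2$ at $p_0$, i.e. $T_{H_0}\Sigma_2+\mathrm dH_{p_0}(T_{p_0}M)=\mathrm{Herm}(n)$; 2. the Jacobian $\mathrm dh_0$ has rank 3; 3. $(h\circ\varphi\circ\gamma)'(0)\ne0$ for every smooth curve $\gamma$ in $M$, defined near $0\in\mathbb R$, with $\gamma(0)=p_0$ and $\gamma'(0)\ne0$; 4. for every such curve $\gamma$ the order of energy splitting of $H\circ\gamma$ is 1, where this order is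 the order at $t=0$, for $t>0$, of the standard deviation $s(t)=\tfrac12\,(\lambda_2-\lambda_1)(H(\gamma(t)))$ of the two lowest eigenvalues, i.e. the supremum in $\{0,1,2,\dots\}\cup\{\infty\}$ of all $r$ with $s(t)=O(t^r)$ as $t\to0^+$. -/

import Mathlib

open scoped Manifold ContDiff Topology

/-- The Hermitian `n × n` matrices. -/
def Herm (n : ℕ) : Type :=
  ↥(selfAdjoint.submodule ℝ (Matrix (Fin n) (Fin n) ℂ))

namespace Herm

section

attribute [local instance] Matrix.frobeniusNormedAddCommGroup Matrix.frobeniusNormedSpace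

/-- The real vector space structure and the Frobenius norm on Hermitian matrices. -/
noncomputable instance instNormedAddCommGroup (n : ℕ) : NormedAddCommGroup (Herm n) :=
  inferInstanceAs (NormedAddCommGroup ↥(selfAdjoint.submodule ℝ (Matrix (Fin n) (Fin n) ℂ)))

noncomputable instance instNormedSpace (n : ℕ) : NormedSpace ℝ (Herm n) :=
  inferInstanceAs (NormedSpace ℝ ↥(selfAdjoint.submodule ℝ (Matrix (Fin n) (Fin n) ℂ)))

end

/-- The underlying complex matrix. -/
def mat {n : ℕ} (A : Herm n) : Matrix (Fin n) (Fin n) ℂ := Subtype.val A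

theorem isHermitian {n : ℕ} (A : Herm n) : A.mat.IsHermitian := A.2

end Herm

/-- The eigenvalues of a Hermitian matrix, with multiplicity, in increasing order (indices from
`0`): `eig A 0 ≤ eig A 1 ≤ … ≤ eig A (n - 1)`. -/
noncomputable def eig {n : ℕ} (A : Herm n) : Fin n → ℝ :=
  A.isHermitian.eigenvalues ∘ Tuple.sort A.isHermitian.eigenvalues

/-- `Σ_k`: the `k`-fold ground-state degenerate matrices, whose `k` lowest eigenvalues coincide and
are smaller than all the others. -/
def SigmaSet (k n : ℕ) : Set (Herm n) :=
  {A | k ≤ n ∧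
    (∀ i j : Fin n, (i : ℕ) < k → (j : ℕ) < k → eig A i = eig A j) ∧
    (∀ i j : Fin n, (i : ℕ) < k → k ≤ (j : ℕ) → eig A i < eig A j)}

/-- The mean of the `k` lowest eigenvalues. -/
noncomputable def meanEig {n : ℕ} (k : ℕ) (A : Herm n) : ℝ :=
  (∑ j ∈ Finset.univ.filter (fun j : Fin n => (j : ℕ) < k), eig A j) / k

/-- The standard deviation `D_k` of the `k` lowest eigenvalues. -/
noncomputable def stdDevEig {n : ℕ} (k : ℕ) (A : Herm n) : ℝ :=
  √((∑ j ∈ Finset.univ.filter (fun j : Fin n => (j : ℕ) < k), (eig A j - meanEig k A) ^ 2) / k)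

/-- The order at `0`, along `t > 0`, of a real function: the largest `r` with `f t = O(t ^ r)` as
`t → 0⁺`, and `⊤` if this holds for all `r`. If `f` is given for small `t ≥ 0` by a power series
or, more generally, by a smooth function, this is the order of the first nonvanishing Taylor
coefficient. -/
noncomputable def ordZero (f : ℝ → ℝ) : ℕ∞ :=
  ⨆ (r : ℕ) (_ : f =O[𝓝[>] (0 : ℝ)] fun t => t ^ r), (r : ℕ∞)

/-- The order of energy splitting of the `k` lowest eigenvalues along a one-parameter family. -/
noncomputable def splittingOrder {n : ℕ} (k : ℕ) (A : ℝ → Herm n) : ℕ∞ :=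
  ordZero fun t => stdDevEig k (A t)

/-- The matrix exponential `e^{iS}`. -/
noncomputable def expI {n : ℕ} (S : Herm n) : Matrix (Fin n) (Fin n) ℂ :=
  NormedSpace.exp (Complex.I • S.mat)

/-- `A = e^{iS} (A₀ + B + T + Heff) e^{-iS}` is a Schrieffer–Wolff decomposition of `A` with respect
to the diagonal matrix `A₀`, for the blocks formed by the first `k` and the last `n - k` indices. -/
structure IsSWDecomposition {n : ℕ} (k : ℕ) (A₀ A S B T Heff : Herm n) : Prop where
  decomp : A.mat =
    expI S * (A₀ + B + T + Heff).mat * expI (-S)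
  /-- `B` lives in the lower right block. -/
  block_B : ∀ a b : Fin n, ((a : ℕ) < k ∨ (b : ℕ) < k) → B.mat a b = 0
  /-- `T` is a scalar matrix in the upper left block. -/
  scalar_T : ∃ c : ℝ, ∀ a b : Fin n, T.mat a b = if a = b ∧ (a : ℕ) < k then (c : ℂ) else 0
  /-- `Heff` lives in the upper left block and is traceless. -/
  block_Heff : ∀ a b : Fin n, (k ≤ (a : ℕ) ∨ k ≤ (b : ℕ)) → Heff.mat a b = 0
  trace_Heff : Matrix.trace Heff.mat = 0
  /-- `S` is off-block. -/
  offBlock_S : ∀ a b : Fin n, ((a : ℕ) < k ↔ (b : ℕ) < k) → S.mat a b = 0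
  /-- The first `k` columns of `e^{iS}` span the sum of the eigenspaces of `A` of its `k` lowest
  eigenvalues. -/
  lowest : Submodule.span ℂ {v : Fin n → ℂ | ∃ a : Fin n, (a : ℕ) < k ∧ v = (expI S).col a} =
    ⨆ (i : Fin n) (_ : (i : ℕ) < k), Module.End.eigenspace (Matrix.toLin' A.mat) (eig A i : ℂ)

/-- `V` and `X` are neighbourhoods of `A₀` and of `0` such that every matrix in `V` has exactly one
Schrieffer–Wolff decomposition with respect to `A₀` with `(S, B, T, Heff) ∈ X`. -/
def IsSWNeighborhoods {n : ℕ} (k : ℕ) (A₀ : Herm n)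
    (V : Set (Herm n)) (X : Set (Herm n × Herm n × Herm n × Herm n)) : Prop :=
  V ∈ 𝓝 A₀ ∧ X ∈ 𝓝 0 ∧
    ∀ A ∈ V, ∃! q : Herm n × Herm n × Herm n × Herm n,
      q ∈ X ∧ IsSWDecomposition k A₀ A q.1 q.2.1 q.2.2.1 q.2.2.2

/-- A fixed choice of neighbourhoods `(V, X)` as in `IsSWNeighborhoods`. Any two choices give the
same decompositions near `A₀`. -/
noncomputable def swNeighborhoods {n : ℕ} (k : ℕ) (A₀ : Herm n) :
    Set (Herm n) × Set (Herm n × Herm n × Herm n × Herm n) :=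
  Classical.epsilon fun q => IsSWNeighborhoods k A₀ q.1 q.2

/-- The traceless effective Hamiltonian of `A` with respect to the diagonal matrix `A₀`, for `A` near
`A₀`: the component `Heff` of the unique Schrieffer–Wolff decomposition of `A`. -/
noncomputable def effectiveHamiltonian {n : ℕ} (k : ℕ) (A₀ A : Herm n) : Herm n :=
  (Classical.epsilon fun q : Herm n × Herm n × Herm n × Herm n =>
    q ∈ (swNeighborhoods k A₀).2 ∧ IsSWDecomposition k A₀ A q.1 q.2.1 q.2.2.1 q.2.2.2).2.2.2

/-- The orthonormal basis `σ_x / √2, σ_y / √2, σ_z / √2` of the traceless Hermitian `2 × 2`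
matrices. -/
noncomputable def pauli : Fin 3 → Matrix (Fin 2) (Fin 2) ℂ :=
  ![((√2)⁻¹ : ℝ) • !![0, 1; 1, 0],
    ((√2)⁻¹ : ℝ) • !![0, -Complex.I; Complex.I, 0],
    ((√2)⁻¹ : ℝ) • !![1, 0; 0, -1]]

/-- A `2 × 2` matrix as an `n × n` matrix supported in the upper left `2 × 2` block. -/
def embedTwo (n : ℕ) (A : Matrix (Fin 2) (Fin 2) ℂ) : Matrix (Fin n) (Fin n) ℂ :=
  Matrix.of fun a b =>
    if hab : (a : ℕ) < 2 ∧ (b : ℕ) < 2 then A ⟨a, hab.1⟩ ⟨b, hab.2⟩ else 0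

/-- The coordinates `(y₁, y₂, y₃)` in the orthonormal basis `pauli` (Frobenius inner products). -/
noncomputable def pauliCoord {n : ℕ} (A : Herm n) : EuclideanSpace ℝ (Fin 3) :=
  WithLp.toLp 2 fun j => (Matrix.trace (embedTwo n (pauli j) * A.mat)).re

/-- The change of basis `U⁻¹ A U` by a unitary matrix `U`. -/
def unitaryConj {n : ℕ} (U : Matrix.unitaryGroup (Fin n) ℂ) (A : Herm n) : Herm n :=
  ⟨star U.1 * A.mat * U.1, by
    have h : star A.mat = A.mat := A.2
    change star (star U.1 * A.mat * U.1) = star U.1 * A.mat * U.1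
    rw [star_mul, star_mul, star_star, h, mul_assoc]⟩

/-- The eigenbasis formed by the columns of the unitary matrix `U` diagonalizes `A`, with the
eigenvalues in increasing order along the diagonal. -/
def Diagonalizes {n : ℕ} (U : Matrix.unitaryGroup (Fin n) ℂ) (A : Herm n) : Prop :=
  (unitaryConj U A).mat = Matrix.diagonal fun i => (eig A i : ℂ)

/-- The effective map `h` of the family `H` at the twofold degeneracy point `p₀`, read in the local
chart `φ` of the parameter manifold and in the eigenbasis `U₀` of `H p₀`. Its germ at `0` is what
matters. -/
noncomputable def effectiveMap {M : Type*} [TopologicalSpace M] {n : ℕ} (H : M → Herm n) (p₀ : M)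
    (U₀ : Matrix.unitaryGroup (Fin n) ℂ)
    (φ : OpenPartialHomeomorph M (EuclideanSpace ℝ (Fin 3))) :
    EuclideanSpace ℝ (Fin 3) → EuclideanSpace ℝ (Fin 3) :=
  fun x => pauliCoord
    (effectiveHamiltonian 2 (unitaryConj U₀ (H p₀)) (unitaryConj U₀ (H (φ.symm x))))

/-- The tangent space at `z` of a submanifold `Z` of a normed space: the velocities at `0` of the
smooth curves in `Z` through `z`. -/
def tangentVectors {E : Type*} [NormedAddCommGroup E] [NormedSpace ℝ E] (Z : Set E) (z : E) :
    Set E :=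
  {v | ∃ (c : ℝ → E) (ε : ℝ), 0 < ε ∧ ContDiffOn ℝ ∞ c (Set.Ioo (-ε) ε) ∧
    (∀ t ∈ Set.Ioo (-ε) ε, c t ∈ Z) ∧ c 0 = z ∧ HasDerivAt c v 0}

/-- `f : M → E` is transverse to `Z ⊆ E` at `p`: `T_{f p} Z + df_p (T_p M) = T_{f p} E`. -/
def IsTransverseAt {m : ℕ} {M : Type*} [TopologicalSpace M]
    [ChartedSpace (EuclideanSpace ℝ (Fin m)) M]
    {E : Type*} [NormedAddCommGroup E] [NormedSpace ℝ E]
    (f : M → E) (Z : Set E) (p : M) : Prop :=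
  ∀ w : E, ∃ v ∈ tangentVectors Z (f p), ∃ u : TangentSpace (𝓡 m) p,
    v + (show E from mfderiv (𝓡 m) 𝓘(ℝ, E) f p u) = w

/-- `γ` is a smooth curve `(ℝ, 0) → (M, p)`, defined near `0`, with `γ'(0) ≠ 0`. -/
def IsRegularCurveAt {m : ℕ} {M : Type*} [TopologicalSpace M]
    [ChartedSpace (EuclideanSpace ℝ (Fin m)) M] (γ : ℝ → M) (p : M) : Prop :=
  γ 0 = p ∧
    (∃ ε : ℝ, 0 < ε ∧ ContMDiffOn 𝓘(ℝ, ℝ) (𝓡 m) ∞ γ (Set.Ioo (-ε) ε)) ∧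
    mfderiv 𝓘(ℝ, ℝ) (𝓡 m) γ 0 (1 : ℝ) ≠ 0

/-! Near `H p₀`, the set `Σ₂` is the zero set of a smooth submersion `Ψ` to `ℝ³`, the Pauli
coordinates of the effective Hamiltonian, and `‖Ψ‖ / √2` is the standard deviation of the two lowest
eigenvalues. Since `h = Ψ ∘ H ∘ φ⁻¹`, all four conditions say that `dh₀ = dΨ ∘ dH ∘ (dφ)⁻¹` is
bijective.

To obtain `Ψ`, a quadruple `(S, B, T, Heff)` is encoded as one Hermitian matrix `G`, whose blocks
are the four components, and `swMap` sends `G` to `e^{iS} (A₀ + B + T + Heff) e^{-iS}`. Its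
derivative at `0` fixes the entries in the diagonal blocks and multiplies the others by `i (d b - d
a)`, which is nonzero by the gap (`swDeriv_injective`). The inverse function theorem then gives
existence, uniqueness and smoothness of the decomposition (`exists_localInverse_swMap`). In the
coordinates `G` the map `Ψ` is linear, namely `pauliCoord`; this gives the submersion property and
`ker dΨ = T Σ₂` (`isSplittingMap_effectiveHamiltonian`). Conjugation by `U₀` transfers this to `H
p₀`.

Given `Ψ`, transversality means that `dΨ ∘ dH` is onto. As `dh₀` is an endomorphism of `ℝ³`, onto is
the same as injective, which is tested on velocities of curves. Along a curve the splitting is `‖h ∘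
φ ∘ γ‖ / √2`, of order 1 exactly when the derivative of `h ∘ φ ∘ γ` at `0` is nonzero
(`ordZero_eq_one_iff`). -/

namespace Herm

variable {n k m : ℕ}

@[ext]
theorem ext {A B : Herm n} (h : ∀ i j, A.mat i j = B.mat i j) : A = B :=
  Subtype.ext (Matrix.ext h)

/-- The top left `k × k` block. -/
def topBlock (D : Herm (k + m)) : Herm k :=
  ⟨D.mat.submatrix (Fin.castAdd m) (Fin.castAdd m), D.isHermitian.submatrix _⟩

/-- The bottom right `m × m` block. -/
def botBlock (D : Herm (k + m)) : Herm m :=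
  ⟨D.mat.submatrix (Fin.natAdd k) (Fin.natAdd k), D.isHermitian.submatrix _⟩

@[simp]
theorem topBlock_apply (D : Herm (k + m)) (i j : Fin k) :
    D.topBlock.mat i j = D.mat (Fin.castAdd m i) (Fin.castAdd m j) := rfl

@[simp]
theorem botBlock_apply (D : Herm (k + m)) (i j : Fin m) :
    D.botBlock.mat i j = D.mat (Fin.natAdd k i) (Fin.natAdd k j) := rfl

/-- The entries outside of the two diagonal blocks vanish. -/
def IsBlockDiag (k : ℕ) (D : Herm n) : Prop :=
  ∀ a b : Fin n, ¬((a : ℕ) < k ↔ (b : ℕ) < k) → D.mat a b = 0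

/-- The Gershgorin discs of the first `k` rows lie to the left of `μ`, the others to the right. -/
def GershgorinGap (k : ℕ) (μ : ℝ) (D : Herm n) : Prop :=
  (∀ a : Fin n, (a : ℕ) < k →
    (D.mat a a).re + ∑ b ∈ Finset.univ.erase a, ‖D.mat a b‖ < μ) ∧
  (∀ a : Fin n, k ≤ (a : ℕ) →
    μ < (D.mat a a).re - ∑ b ∈ Finset.univ.erase a, ‖D.mat a b‖)

end Herm

open Herm

/-! ### Sorted spectrum and low eigenspaces of block diagonal matrices -/

section Eig

variable {n k m : ℕ}

theorem eig_monotone (A : Herm n) : Monotone (eig A) :=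
  Tuple.monotone_sort _

theorem map_eig_univ (A : Herm n) :
    (Finset.univ.val.map (eig A)) = Finset.univ.val.map A.isHermitian.eigenvalues := by
  rw [eig, ← Multiset.map_map]
  congr 1
  exact congrArg Finset.val (Finset.map_univ_equiv (Tuple.sort A.isHermitian.eigenvalues))

theorem eq_of_monotone_of_map_univ_eq {f g : Fin n → ℝ} (hf : Monotone f) (hg : Monotone g)
    (h : Finset.univ.val.map f = Finset.univ.val.map g) : f = g := by
  rw [Fin.univ_val_map, Fin.univ_val_map, Multiset.coe_eq_coe] at h
  exact List.ofFn_injective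
    (h.eq_of_pairwise' hf.sortedLE_ofFn.pairwise hg.sortedLE_ofFn.pairwise)

theorem roots_charpoly_eq_map_eig (A : Herm n) :
    A.mat.charpoly.roots = (Finset.univ.val.map (eig A)).map (fun x : ℝ => (x : ℂ)) := by
  rw [map_eig_univ, A.isHermitian.roots_charpoly_eq_eigenvalues, Multiset.map_map]
  rfl

theorem map_eig_eq_of_roots {A : Herm n} {s : Multiset ℝ}
    (h : A.mat.charpoly.roots = s.map (fun x : ℝ => (x : ℂ))) :
    Finset.univ.val.map (eig A) = s := by
  rw [roots_charpoly_eq_map_eig] at h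
  exact Multiset.map_injective Complex.ofReal_injective h

theorem eig_eq_of_charpoly_eq {A B : Herm n} (h : A.mat.charpoly = B.mat.charpoly) :
    eig A = eig B := by
  refine eq_of_monotone_of_map_univ_eq (eig_monotone A) (eig_monotone B) ?_
  exact map_eig_eq_of_roots (by rw [h, roots_charpoly_eq_map_eig])

theorem exists_eig_eq_eigenvalues (A : Herm n) (j : Fin n) :
    ∃ i, A.isHermitian.eigenvalues j = eig A i :=
  ⟨(Tuple.sort A.isHermitian.eigenvalues).symm j, by simp [eig]⟩

theorem hasEigenvalue_eig (A : Herm n) (i : Fin n) :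
    Module.End.HasEigenvalue (Matrix.toLin' A.mat) (eig A i : ℂ) := by
  set j := Tuple.sort A.isHermitian.eigenvalues i
  refine Module.End.hasEigenvalue_of_hasEigenvector
    (x := ⇑(A.isHermitian.eigenvectorBasis j)) ⟨?_, ?_⟩
  · rw [Module.End.mem_eigenspace_iff, Matrix.toLin'_apply, A.isHermitian.mulVec_eigenvectorBasis]
    rfl
  · intro h
    apply A.isHermitian.eigenvectorBasis.orthonormal.ne_zero j
    ext a
    exact congrFun h a

theorem sum_erase_castAdd_le (D : Herm (k + m)) (a : Fin k) :
    ∑ b ∈ Finset.univ.erase a, ‖D.topBlock.mat a b‖ ≤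
      ∑ b ∈ Finset.univ.erase (Fin.castAdd m a), ‖D.mat (Fin.castAdd m a) b‖ := by
  simp only [topBlock_apply]
  rw [← Finset.sum_image (f := fun b => ‖D.mat (Fin.castAdd m a) b‖) (g := Fin.castAdd m)
    ((Fin.castAdd_injective k m).injOn)]
  refine Finset.sum_le_sum_of_subset_of_nonneg ?_ fun _ _ _ => norm_nonneg _
  intro b hb
  obtain ⟨c, hc, rfl⟩ := Finset.mem_image.1 hb
  simpa using hc

theorem sum_erase_natAdd_le (D : Herm (k + m)) (a : Fin m) :
    ∑ b ∈ Finset.univ.erase a, ‖D.botBlock.mat a b‖ ≤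
      ∑ b ∈ Finset.univ.erase (Fin.natAdd k a), ‖D.mat (Fin.natAdd k a) b‖ := by
  simp only [botBlock_apply]
  rw [← Finset.sum_image (f := fun b => ‖D.mat (Fin.natAdd k a) b‖) (g := Fin.natAdd k)
    ((Fin.natAdd_injective m k).injOn)]
  refine Finset.sum_le_sum_of_subset_of_nonneg ?_ fun _ _ _ => norm_nonneg _
  intro b hb
  obtain ⟨c, hc, rfl⟩ := Finset.mem_image.1 hb
  simpa using hc

/-- Gershgorin's circle theorem separates the spectra of the blocks by a condition on entries, which
is open by inspection; continuity of eigenvalues is never needed. -/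
theorem lt_of_hasEigenvalue_topBlock {μ t : ℝ} {D : Herm (k + m)} (hD : GershgorinGap k μ D)
    (ht : Module.End.HasEigenvalue (Matrix.toLin' D.topBlock.mat) (t : ℂ)) : t < μ := by
  obtain ⟨a, ha⟩ := eigenvalue_mem_ball ht
  have h1 := hD.1 (Fin.castAdd m a) (by simp)
  have h2 := sum_erase_castAdd_le D a
  have h3 := (Complex.abs_re_le_norm _).trans (mem_closedBall_iff_norm.1 ha)
  have h4 := (abs_le.1 h3).2
  simp only [Complex.sub_re, Complex.ofReal_re, topBlock_apply] at h4 h2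
  linarith

theorem lt_of_hasEigenvalue_botBlock {μ t : ℝ} {D : Herm (k + m)} (hD : GershgorinGap k μ D)
    (ht : Module.End.HasEigenvalue (Matrix.toLin' D.botBlock.mat) (t : ℂ)) : μ < t := by
  obtain ⟨a, ha⟩ := eigenvalue_mem_ball ht
  have h1 := hD.2 (Fin.natAdd k a) (by simp)
  have h2 := sum_erase_natAdd_le D a
  have h3 := (Complex.abs_re_le_norm _).trans (mem_closedBall_iff_norm.1 ha)
  have h4 := (abs_le.1 h3).1
  simp only [Complex.sub_re, Complex.ofReal_re, botBlock_apply] at h4 h2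
  linarith

theorem reindex_eq_fromBlocks {D : Herm (k + m)} (hD : IsBlockDiag k D) :
    Matrix.reindex finSumFinEquiv.symm finSumFinEquiv.symm D.mat =
      Matrix.fromBlocks D.topBlock.mat 0 0 D.botBlock.mat := by
  ext (i | i) (j | j)
  · simp
  · simpa using hD _ _ (by simp)
  · simpa using hD _ _ (by simp)
  · simp

/-- The characteristic polynomial factors over the blocks, so both sides list the same multiset. The
number `μ` separates the two spectra, so the concatenation is already sorted, and a sorted list is
determined by its multiset. -/
theorem eig_eq_append {μ : ℝ} {A D : Herm (k + m)} (hD : IsBlockDiag k D)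
    (hgap : GershgorinGap k μ D) (h : A.mat.charpoly = D.mat.charpoly) :
    eig A = Fin.append (eig D.topBlock) (eig D.botBlock) := by
  have hlt : ∀ i j, eig D.topBlock i < eig D.botBlock j := fun i j =>
    (lt_of_hasEigenvalue_topBlock hgap (hasEigenvalue_eig _ i)).trans
      (lt_of_hasEigenvalue_botBlock hgap (hasEigenvalue_eig _ j))
  refine eq_of_monotone_of_map_univ_eq (eig_monotone A) ?_ ?_
  · intro i j hij
    induction i using Fin.addCases with
    | left i =>
      induction j using Fin.addCases with
      | left j => simpa using eig_monotone D.topBlock (show i ≤ j from hij)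
      | right j => simpa using (hlt i j).le
    | right i =>
      induction j using Fin.addCases with
      | left j =>
        have := j.2
        simp only [Fin.le_def, Fin.val_natAdd, Fin.val_castAdd] at hij
        omega
      | right j =>
        have hij' : i ≤ j := Fin.le_def.2 (by
          have := Fin.le_def.1 hij
          rw [Fin.val_natAdd, Fin.val_natAdd] at this
          omega)
        simpa using eig_monotone D.botBlock hij'
  · apply map_eig_eq_of_roots
    have h1 : A.mat.charpoly = D.topBlock.mat.charpoly * D.botBlock.mat.charpoly := by
      rw [h, ← Matrix.charpoly_reindex finSumFinEquiv.symm, reindex_eq_fromBlocks hD,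
        Matrix.charpoly_fromBlocks_zero₁₂]
    rw [h1, Polynomial.roots_mul
      (mul_ne_zero (Matrix.charpoly_monic _).ne_zero (Matrix.charpoly_monic _).ne_zero),
      roots_charpoly_eq_map_eig, roots_charpoly_eq_map_eig, ← Multiset.map_add]
    congr 1
    rw [Fin.univ_val_map, Fin.univ_val_map, Fin.univ_val_map, List.ofFn_fin_append,
      Multiset.coe_add]

theorem eig_castAdd_lt {μ : ℝ} {D : Herm (k + m)} (hgap : GershgorinGap k μ D) (i : Fin k) :
    eig D.topBlock i < μ :=
  lt_of_hasEigenvalue_topBlock hgap (hasEigenvalue_eig _ i)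

theorem charpoly_eq_of_conj {A D : Herm n} {W W' : Matrix (Fin n) (Fin n) ℂ} (hW : W * W' = 1)
    (hA : A.mat = W * D.mat * W') : A.mat.charpoly = D.mat.charpoly := by
  rw [hA, mul_assoc, Matrix.charpoly_mul_comm, mul_assoc, mul_eq_one_comm.1 hW, mul_one]

theorem mulVec_append_zero {D : Herm (k + m)} (hD : IsBlockDiag k D) (u : Fin k → ℂ) :
    D.mat.mulVec (Fin.append u 0) = Fin.append (D.topBlock.mat.mulVec u) 0 := by
  ext i
  induction i using Fin.addCases with
  | left i => simp [Matrix.mulVec, dotProduct, Fin.sum_univ_add]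
  | right i =>
    have : ∀ j : Fin k, D.mat (Fin.natAdd k i) (Fin.castAdd m j) = 0 :=
      fun j => hD _ _ (by simp)
    simp [Matrix.mulVec, dotProduct, Fin.sum_univ_add, this]

theorem botBlock_mulVec {D : Herm (k + m)} (hD : IsBlockDiag k D) (w : Fin (k + m) → ℂ) :
    D.botBlock.mat.mulVec (w ∘ Fin.natAdd k) = D.mat.mulVec w ∘ Fin.natAdd k := by
  ext i
  have : ∀ j : Fin k, D.mat (Fin.natAdd k i) (Fin.castAdd m j) = 0 :=
    fun j => hD _ _ (by simp)
  simp [Matrix.mulVec, dotProduct, Fin.sum_univ_add, this]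

/-- Conjugation by `W` turns this into the claim for `D`, where the low eigenvectors are exactly
those supported on the first `k` coordinates. It supplies the field `lowest` of a Schrieffer–Wolff
decomposition. -/
theorem span_col_eq_iSup_eigenspace_aux {μ : ℝ} {A D : Herm (k + m)} (hD : IsBlockDiag k D)
    (hgap : GershgorinGap k μ D) {W W' : Matrix (Fin (k + m)) (Fin (k + m)) ℂ} (hW : W * W' = 1)
    (hA : A.mat = W * D.mat * W') :
    Submodule.span ℂ {v : Fin (k + m) → ℂ | ∃ a : Fin (k + m), (a : ℕ) < k ∧ v = W.col a} =
      ⨆ (i : Fin (k + m)) (_ : (i : ℕ) < k),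
        Module.End.eigenspace (Matrix.toLin' A.mat) (eig A i : ℂ) := by
  have hW' : W' * W = 1 := mul_eq_one_comm.1 hW
  have heig := eig_eq_append hD hgap (charpoly_eq_of_conj hW hA)
  apply le_antisymm
  · let f : (Fin k → ℂ) →ₗ[ℂ] (Fin (k + m) → ℂ) :=
      (Matrix.toLin' W).comp
        ({
          toFun := fun u => Fin.append u 0
          map_add' := fun u v => by
            ext i; induction i using Fin.addCases <;> simp
          map_smul' := fun c u => by
            ext i; induction i using Fin.addCases <;> simp } :
          (Fin k → ℂ) →ₗ[ℂ] (Fin (k + m) → ℂ))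
    have hf : ∀ u, f u = W.mulVec (Fin.append u 0) := fun u => rfl
    set P := ⨆ (i : Fin (k + m)) (_ : (i : ℕ) < k),
        Module.End.eigenspace (Matrix.toLin' A.mat) (eig A i : ℂ) with hP
    let e := D.topBlock.isHermitian.eigenvectorBasis
    -- It suffices to check an eigenbasis of the top block: extended by zero and moved by `W`, its
    -- members are eigenvectors of `A` for low eigenvalues.
    have key : ∀ x : EuclideanSpace ℂ (Fin k), f x.ofLp ∈ P := by
      have htop : (⊤ : Submodule ℂ (EuclideanSpace ℂ (Fin k))) ≤
          P.comap (f.comp (WithLp.linearEquiv 2 ℂ (Fin k → ℂ)).toLinearMap) := by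
        rw [← e.toBasis.span_eq, Submodule.span_le]
        rintro _ ⟨j, rfl⟩
        obtain ⟨i, hi⟩ := exists_eig_eq_eigenvalues D.topBlock j
        have hi' : eig A (Fin.castAdd m i) = D.topBlock.isHermitian.eigenvalues j := by
          rw [heig, Fin.append_left, hi]
        refine Submodule.mem_iSup_of_mem (Fin.castAdd m i)
          (Submodule.mem_iSup_of_mem (by simp) ?_)
        rw [Module.End.mem_eigenspace_iff, Matrix.toLin'_apply, hA, hi']
        have h1 := D.topBlock.isHermitian.mulVec_eigenvectorBasis j
        have h2 : (f.comp (WithLp.linearEquiv 2 ℂ (Fin k → ℂ)).toLinearMap) (e.toBasis j) =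
            W.mulVec (Fin.append (e j).ofLp 0) := by
          simp [hf]
        rw [h2, Matrix.mulVec_mulVec, mul_assoc, mul_assoc, hW', mul_one,
          ← Matrix.mulVec_mulVec, mulVec_append_zero hD, h1, ← Matrix.mulVec_smul]
        congr 1
        ext i; induction i using Fin.addCases <;> simp [e]
      intro x
      exact htop (Submodule.mem_top (x := x))
    rw [Submodule.span_le]
    rintro _ ⟨a, ha, rfl⟩
    obtain ⟨a, rfl⟩ : ∃ b : Fin k, a = Fin.castAdd m b := ⟨⟨a, ha⟩, rfl⟩
    have := key (WithLp.toLp 2 (Pi.single a 1))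
    rw [hf] at this
    have h3 : (Fin.append (Pi.single a 1) 0 : Fin (k + m) → ℂ) = Pi.single (Fin.castAdd m a) 1 := by
      ext i
      induction i using Fin.addCases with
      | left i => simp [Pi.single_apply]
      | right i =>
        simp [Pi.single_apply, Fin.ext_iff]
        omega
    change W.mulVec (Fin.append (Pi.single a 1) 0) ∈ P at this
    rw [h3, Matrix.mulVec_single_one] at this
    exact this
  · refine iSup_le fun i => iSup_le fun hi v hv => ?_
    obtain ⟨i, rfl⟩ : ∃ b : Fin k, i = Fin.castAdd m b := ⟨⟨i, hi⟩, rfl⟩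
    rw [Module.End.mem_eigenspace_iff, Matrix.toLin'_apply, hA] at hv
    set w := W'.mulVec v with hw
    set t := eig A (Fin.castAdd m i) with ht
    have htμ : t < μ := by
      rw [ht, heig, Fin.append_left]
      exact eig_castAdd_lt hgap i
    have hDw : D.mat.mulVec w = (t : ℂ) • w := by
      rw [hw, ← Matrix.mulVec_smul, ← hv, Matrix.mulVec_mulVec, Matrix.mulVec_mulVec,
        mul_assoc, ← mul_assoc W', hW', one_mul]
    -- A nonzero lower part would be an eigenvector of the bottom block for `t < μ`, but the
    -- eigenvalues there exceed `μ`.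
    have hw0 : w ∘ Fin.natAdd k = 0 := by
      by_contra hne
      refine lt_irrefl t (htμ.trans (lt_of_hasEigenvalue_botBlock hgap
        (Module.End.hasEigenvalue_of_hasEigenvector (x := w ∘ Fin.natAdd k) ⟨?_, hne⟩)))
      rw [Module.End.mem_eigenspace_iff, Matrix.toLin'_apply, botBlock_mulVec hD, hDw]
      rfl
    have hv' : v = ∑ a, w a • W.col a := by
      have : v = W.mulVec w := by rw [hw, Matrix.mulVec_mulVec, hW, Matrix.one_mulVec]
      rw [this]
      ext b
      simp [Matrix.mulVec, dotProduct, mul_comm]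
    rw [hv']
    refine Submodule.sum_mem _ fun a _ => ?_
    induction a using Fin.addCases with
    | left a => exact Submodule.smul_mem _ _ (Submodule.subset_span ⟨_, by simp, rfl⟩)
    | right a =>
      have : w (Fin.natAdd k a) = 0 := congrFun hw0 a
      simp [this]

theorem span_col_eq_iSup_eigenspace {μ : ℝ} {A D : Herm n} (hk : k ≤ n) (hD : IsBlockDiag k D)
    (hgap : GershgorinGap k μ D) {W W' : Matrix (Fin n) (Fin n) ℂ} (hW : W * W' = 1)
    (hA : A.mat = W * D.mat * W') :
    Submodule.span ℂ {v : Fin n → ℂ | ∃ a : Fin n, (a : ℕ) < k ∧ v = W.col a} =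
      ⨆ (i : Fin n) (_ : (i : ℕ) < k),
        Module.End.eigenspace (Matrix.toLin' A.mat) (eig A i : ℂ) := by
  obtain ⟨m, rfl⟩ := Nat.exists_eq_add_of_le hk
  exact span_col_eq_iSup_eigenspace_aux hD hgap hW hA

end Eig

/-! ### The splitting of two levels -/

section TwoByTwo

theorem eig_add_eig_two (A : Herm 2) : eig A 0 + eig A 1 = (A.mat 0 0).re + (A.mat 1 1).re := by
  have h := congrArg Multiset.sum (map_eig_univ A)
  have h2 := A.isHermitian.trace_eq_sum_eigenvalues
  have h3 : (A.isHermitian.eigenvalues 0 + A.isHermitian.eigenvalues 1 : ℝ) =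
      (A.mat.trace).re := by
    rw [h2]; simp
  have h4 : ∑ i, eig A i = ∑ i, A.isHermitian.eigenvalues i := h
  rw [Fin.sum_univ_two, Fin.sum_univ_two] at h4
  rw [h4, h3]
  simp [Matrix.trace]

theorem eig_mul_eig_two (A : Herm 2) :
    eig A 0 * eig A 1 = (A.mat 0 0).re * (A.mat 1 1).re - ‖A.mat 0 1‖ ^ 2 := by
  have h := congrArg Multiset.prod (map_eig_univ A)
  have h2 := A.isHermitian.det_eq_prod_eigenvalues
  have h3 : (A.isHermitian.eigenvalues 0 * A.isHermitian.eigenvalues 1 : ℝ) =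
      (A.mat.det).re := by
    rw [h2]; simp
  have h4 : ∏ i, eig A i = ∏ i, A.isHermitian.eigenvalues i := h
  rw [Fin.prod_univ_two, Fin.prod_univ_two] at h4
  rw [h4, h3, Matrix.det_fin_two]
  have h00 : (A.mat 0 0).im = 0 := by
    have := congrArg Complex.im (A.isHermitian.apply 0 0)
    simp at this; linarith
  have h10 : A.mat 1 0 = star (A.mat 0 1) := (A.isHermitian.apply 1 0).symm
  rw [h10, Complex.sub_re, Complex.mul_re, h00]
  simp [← Complex.normSq_eq_norm_sq, Complex.normSq_apply]

/-- This is the discriminant, trace squared minus four times the determinant. -/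
theorem sq_eig_sub_eig_two (A : Herm 2) : (eig A 1 - eig A 0) ^ 2 =
    ((A.mat 0 0).re - (A.mat 1 1).re) ^ 2 + 4 * ‖A.mat 0 1‖ ^ 2 := by
  linear_combination (eig A 0 + eig A 1 + (A.mat 0 0).re + (A.mat 1 1).re) * eig_add_eig_two A
    - 4 * eig_mul_eig_two A

theorem stdDevEig_two {m : ℕ} (A : Herm (2 + m)) :
    stdDevEig 2 A = (eig A (Fin.castAdd m 1) - eig A (Fin.castAdd m 0)) / 2 := by
  have hf : Finset.univ.filter (fun j : Fin (2 + m) => (j : ℕ) < 2) =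
      {Fin.castAdd m 0, Fin.castAdd m 1} := by
    ext j
    rw [Finset.mem_filter, Finset.mem_insert, Finset.mem_singleton, Fin.ext_iff, Fin.ext_iff,
      Fin.val_castAdd, Fin.val_castAdd]
    simp only [Finset.mem_univ, true_and, Fin.val_zero, Fin.val_one]
    omega
  have hne : (Fin.castAdd m 0 : Fin (2 + m)) ≠ Fin.castAdd m 1 := by simp
  have hle : eig A (Fin.castAdd m 0) ≤ eig A (Fin.castAdd m 1) :=
    eig_monotone A (by simp [Fin.le_def])
  rw [stdDevEig, meanEig, hf, Finset.sum_pair hne, Finset.sum_pair hne]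
  rw [Real.sqrt_eq_iff_eq_sq (by positivity) (by linarith)]
  push_cast
  ring

/-- The strict inequalities in the definition of `Σ₂` come for free from the Gershgorin gap, so only
the equality of the two lowest eigenvalues remains. -/
theorem mem_SigmaSet_two_iff {m : ℕ} {μ : ℝ} {A D : Herm (2 + m)} (hD : IsBlockDiag 2 D)
    (hgap : GershgorinGap 2 μ D) (h : A.mat.charpoly = D.mat.charpoly) :
    A ∈ SigmaSet 2 (2 + m) ↔ stdDevEig 2 A = 0 := by
  have heig := eig_eq_append hD hgap h
  rw [stdDevEig_two, div_eq_zero_iff, or_iff_left two_ne_zero, sub_eq_zero]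
  constructor
  · rintro ⟨-, h1, -⟩
    exact h1 _ _ (by simp) (by simp)
  · intro h1
    refine ⟨by omega, fun i j hi hj => ?_, fun i j hi hj => ?_⟩
    · obtain ⟨i, rfl⟩ : ∃ b : Fin 2, i = Fin.castAdd m b := ⟨⟨i, hi⟩, rfl⟩
      obtain ⟨j, rfl⟩ : ∃ b : Fin 2, j = Fin.castAdd m b := ⟨⟨j, hj⟩, rfl⟩
      fin_cases i <;> fin_cases j <;> simp_all
    · obtain ⟨i, rfl⟩ : ∃ b : Fin 2, i = Fin.castAdd m b := ⟨⟨i, hi⟩, rfl⟩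
      obtain ⟨j, rfl⟩ : ∃ b : Fin m, j = Fin.natAdd 2 b :=
        ⟨⟨j - 2, by omega⟩, by ext; simp; omega⟩
      rw [heig, Fin.append_left, Fin.append_right]
      exact (lt_of_hasEigenvalue_topBlock hgap (hasEigenvalue_eig _ i)).trans
        (lt_of_hasEigenvalue_botBlock hgap (hasEigenvalue_eig _ j))

theorem sq_stdDevEig_two {m : ℕ} {μ : ℝ} {A D : Herm (2 + m)} (hD : IsBlockDiag 2 D)
    (hgap : GershgorinGap 2 μ D) (h : A.mat.charpoly = D.mat.charpoly) :
    (2 * stdDevEig 2 A) ^ 2 =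
      ((D.topBlock.mat 0 0).re - (D.topBlock.mat 1 1).re) ^ 2 + 4 * ‖D.topBlock.mat 0 1‖ ^ 2 := by
  rw [← sq_eig_sub_eig_two, stdDevEig_two, eig_eq_append hD hgap h, Fin.append_left,
    Fin.append_left]
  ring

end TwoByTwo

/-! ### Linear structure of Hermitian matrices and the splitting into four components -/

namespace Herm

variable {n k : ℕ}

instance instFiniteDimensional (n : ℕ) : FiniteDimensional ℝ (Herm n) :=
  inferInstanceAs (FiniteDimensional ℝ ↥(selfAdjoint.submodule ℝ (Matrix (Fin n) (Fin n) ℂ)))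

instance instCompleteSpace (n : ℕ) : CompleteSpace (Herm n) :=
  FiniteDimensional.complete ℝ (Herm n)

@[simp] theorem mat_zero : (0 : Herm n).mat = 0 := rfl
@[simp] theorem mat_add (A B : Herm n) : (A + B).mat = A.mat + B.mat := rfl
@[simp] theorem mat_sub (A B : Herm n) : (A - B).mat = A.mat - B.mat := rfl
@[simp] theorem mat_neg (A : Herm n) : (-A).mat = -A.mat := rfl
@[simp] theorem mat_smul (c : ℝ) (A : Herm n) : (c • A).mat = c • A.mat := rfl

theorem star_mat (A : Herm n) : star A.mat = A.mat := A.2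

theorem mat_injective : Function.Injective (mat : Herm n → Matrix (Fin n) (Fin n) ℂ) :=
  Subtype.val_injective

/-- The inclusion into all matrices. -/
def matₗ (n : ℕ) : Herm n →ₗ[ℝ] Matrix (Fin n) (Fin n) ℂ where
  toFun := mat
  map_add' _ _ := rfl
  map_smul' _ _ := rfl

/-- The Hermitian part of a matrix. -/
noncomputable def hermPart (n : ℕ) : Matrix (Fin n) (Fin n) ℂ →ₗ[ℝ] Herm n where
  toFun X := ⟨(2⁻¹ : ℝ) • (X + star X), by
    change star ((2⁻¹ : ℝ) • (X + star X)) = _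
    rw [star_smul, star_add, star_star, add_comm, star_trivial]⟩
  map_add' X Y := mat_injective (by
    change (2⁻¹ : ℝ) • (X + Y + star (X + Y)) = (2⁻¹ : ℝ) • (X + star X) + (2⁻¹ : ℝ) • (Y + star Y)
    rw [star_add, ← smul_add]; congr 1; abel)
  map_smul' c X := mat_injective (by
    change (2⁻¹ : ℝ) • (c • X + star (c • X)) = c • (2⁻¹ : ℝ) • (X + star X)
    rw [star_smul, star_trivial, ← smul_add, smul_comm])

theorem hermPart_mat (A : Herm n) : hermPart n A.mat = A := mat_injective (by
  change (2⁻¹ : ℝ) • (A.mat + star A.mat) = A.mat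
  rw [star_mat, ← two_smul ℝ A.mat, smul_smul]; norm_num)

/-- The entries of a Hermitian matrix that satisfy a symmetric condition. -/
def mask (p : Fin n → Fin n → Prop) [DecidableRel p] (hp : ∀ a b, p a b ↔ p b a) :
    Herm n →ₗ[ℝ] Herm n where
  toFun G := ⟨Matrix.of fun a b => if p a b then G.mat a b else 0, by
    refine Matrix.ext fun a b => ?_
    have := G.isHermitian.apply a b
    simp only [Matrix.star_apply, Matrix.of_apply, hp b a]
    split_ifs
    · exact this
    · simp⟩
  map_add' G K := by
    ext a b
    change (if p a b then G.mat a b + K.mat a b else 0) =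
      (if p a b then G.mat a b else 0) + (if p a b then K.mat a b else 0)
    split_ifs <;> simp
  map_smul' c G := by
    ext a b
    change (if p a b then (c : ℝ) • G.mat a b else 0) = (c : ℝ) • (if p a b then G.mat a b else 0)
    split_ifs <;> simp

/-- The part outside of the two diagonal blocks. -/
def offPart (n k : ℕ) : Herm n →ₗ[ℝ] Herm n :=
  mask (fun a b => ¬((a : ℕ) < k ↔ (b : ℕ) < k)) (fun _ _ => not_congr iff_comm)

/-- The lower right block. -/
def botPart (n k : ℕ) : Herm n →ₗ[ℝ] Herm n :=
  mask (fun a b => k ≤ (a : ℕ) ∧ k ≤ (b : ℕ)) (fun _ _ => and_comm)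

/-- The upper left block. -/
def topPart (n k : ℕ) : Herm n →ₗ[ℝ] Herm n :=
  mask (fun a b => (a : ℕ) < k ∧ (b : ℕ) < k) (fun _ _ => and_comm)

theorem offPart_apply (G : Herm n) (a b : Fin n) :
    (offPart n k G).mat a b = if ¬((a : ℕ) < k ↔ (b : ℕ) < k) then G.mat a b else 0 := rfl

theorem botPart_apply (G : Herm n) (a b : Fin n) :
    (botPart n k G).mat a b = if k ≤ (a : ℕ) ∧ k ≤ (b : ℕ) then G.mat a b else 0 := rfl

theorem topPart_apply (G : Herm n) (a b : Fin n) :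
    (topPart n k G).mat a b = if (a : ℕ) < k ∧ (b : ℕ) < k then G.mat a b else 0 := rfl

/-- The projection onto the upper left block. -/
noncomputable def topId (n k : ℕ) : Herm n :=
  ⟨Matrix.diagonal fun a => if (a : ℕ) < k then 1 else 0, by
    change star (Matrix.diagonal _) = _
    rw [Matrix.star_eq_conjTranspose, Matrix.diagonal_conjTranspose]
    congr 1
    ext a
    simp only [Pi.star_apply]
    split_ifs <;> simp⟩

theorem topId_apply (a b : Fin n) :
    (topId n k).mat a b = if a = b ∧ (a : ℕ) < k then 1 else 0 := by
  change (Matrix.diagonal _) a b = _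
  rw [Matrix.diagonal_apply, ite_and]

/-- The trace of a Hermitian matrix. -/
def reTrace (n : ℕ) : Herm n →ₗ[ℝ] ℝ where
  toFun A := A.mat.trace.re
  map_add' A B := by simp [Matrix.trace_add]
  map_smul' c A := by simp [Matrix.trace_smul]

theorem trace_eq_reTrace (A : Herm n) : A.mat.trace = (reTrace n A : ℂ) := by
  refine Complex.ext rfl ?_
  rw [Complex.ofReal_im, ← Complex.conj_eq_iff_im]
  change star A.mat.trace = _
  rw [← Matrix.trace_conjTranspose, A.isHermitian]

/-- The scalar component of the upper left block. -/
noncomputable def scalarPart (n k : ℕ) : Herm n →ₗ[ℝ] Herm n :=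
  ((k : ℝ)⁻¹ • (reTrace n).comp (topPart n k)).smulRight (topId n k)

theorem scalarPart_eq (G : Herm n) :
    scalarPart n k G = ((k : ℝ)⁻¹ * reTrace n (topPart n k G)) • topId n k := rfl

/-- The traceless component of the upper left block. -/
noncomputable def effPart (n k : ℕ) : Herm n →ₗ[ℝ] Herm n := topPart n k - scalarPart n k

theorem effPart_eq (G : Herm n) : effPart n k G = topPart n k G - scalarPart n k G := rfl

/-- This allows a quadruple of components to be stored as a single matrix, their sum. -/
theorem parts_add (G : Herm n) :
    offPart n k G + botPart n k G + scalarPart n k G + effPart n k G = G := by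
  rw [effPart_eq]
  ext a b
  simp only [mat_add, mat_sub, Matrix.add_apply, Matrix.sub_apply, offPart_apply, botPart_apply,
    topPart_apply]
  by_cases ha : (a : ℕ) < k <;> by_cases hb : (b : ℕ) < k <;>
    simp [ha, hb, not_le.2, not_lt.1]

theorem reTrace_topId (h : k ≤ n) : reTrace n (topId n k) = k := by
  change (Matrix.trace (Matrix.diagonal fun a : Fin n => if (a : ℕ) < k then (1 : ℂ) else 0)).re = _
  obtain ⟨m, rfl⟩ := Nat.exists_eq_add_of_le h
  simp [Matrix.trace_diagonal, Fin.card_filter_val_lt]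

theorem reTrace_effPart (hk : 0 < k) (h : k ≤ n) (G : Herm n) : reTrace n (effPart n k G) = 0 := by
  have : (k : ℝ) ≠ 0 := by positivity
  rw [effPart_eq, map_sub, scalarPart_eq, map_smul, reTrace_topId h, smul_eq_mul]
  field_simp
  ring

end Herm

/-! ### Unitary conjugation by matrix exponentials -/

section Exp

variable {n : ℕ}

theorem star_expI (S : Herm n) : star (expI S) = expI (-S) := by
  rw [expI, expI, Matrix.star_eq_conjTranspose, ← Matrix.exp_conjTranspose,
    Matrix.conjTranspose_smul, S.isHermitian, mat_neg]
  simp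

theorem expI_mul_expI_neg (S : Herm n) : expI S * expI (-S) = 1 := by
  rw [expI, expI, mat_neg, smul_neg, Matrix.exp_neg]
  exact Matrix.mul_nonsing_inv _ ((Matrix.isUnit_iff_isUnit_det _).1 (Matrix.isUnit_exp _))

/-- The conjugate `e^{iS} A e^{-iS}`. -/
noncomputable def expConj (S A : Herm n) : Herm n :=
  ⟨expI S * A.mat * expI (-S), by
    change star (expI S * A.mat * expI (-S)) = _
    rw [star_mul, star_mul, star_expI, star_expI, neg_neg, star_mat, mul_assoc]⟩

theorem expConj_mat (S A : Herm n) : (expConj S A).mat = expI S * A.mat * expI (-S) := rfl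

end Exp

/-! ### Differentiating conjugation by an exponential in a Banach algebra -/

section Banach

variable {E F 𝔸 : Type*} [NormedAddCommGroup E] [NormedSpace ℝ E] [NormedAddCommGroup F]
  [NormedSpace ℝ F] [NormedRing 𝔸] [NormedAlgebra ℝ 𝔸] [CompleteSpace 𝔸]

theorem contDiff_exp_conj (π : 𝔸 →L[ℝ] F) (f g : E →L[ℝ] 𝔸) (a : 𝔸) :
    ContDiff ℝ ∞ fun x => π (NormedSpace.exp (f x) * (a + g x) * NormedSpace.exp (-f x)) := by
  have hexp : ContDiff ℝ ∞ (NormedSpace.exp : 𝔸 → 𝔸) :=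
    contDiff_iff_contDiffAt.2 fun x => (NormedSpace.exp_analytic (𝕂 := ℝ) x).contDiffAt
  exact π.contDiff.comp (((hexp.comp f.contDiff).mul (contDiff_const.add g.contDiff)).mul
    (hexp.comp f.contDiff.neg))

/-- The exponential has derivative `1` at `0`, so the product rule leaves the commutator of `f x`
with `a`, plus `g x`. -/
theorem hasFDerivAt_exp_conj (π : 𝔸 →L[ℝ] F) (f g : E →L[ℝ] 𝔸) (a : 𝔸) (L : E →L[ℝ] F)
    (hL : ∀ x, L x = π (f x * a + g x - a * f x)) :
    HasFDerivAt (fun x => π (NormedSpace.exp (f x) * (a + g x) * NormedSpace.exp (-f x)))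
      L 0 := by
  have hexp : HasFDerivAt (NormedSpace.exp : 𝔸 → 𝔸) (1 : 𝔸 →L[ℝ] 𝔸) 0 := hasFDerivAt_exp_zero
  have hcomp : ∀ f : E →L[ℝ] 𝔸, HasFDerivAt (fun x => NormedSpace.exp (f x)) f 0 := fun f => by
    rw [← map_zero f] at hexp
    exact hexp.comp (0 : E) f.hasFDerivAt
  have h1 := hcomp f
  have h2 : HasFDerivAt (fun x => NormedSpace.exp (-f x)) (-f) 0 := hcomp (-f)
  have h3 : HasFDerivAt (fun x => a + g x) g 0 := g.hasFDerivAt.const_add a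
  have h4 := π.hasFDerivAt.comp (0 : E) ((h1.mul' h3).mul' h2)
  refine h4.congr_fderiv ?_
  ext x
  simp [hL, NormedSpace.exp_zero]
  abel

end Banach

/-! ### The Schrieffer–Wolff decomposition by the inverse function theorem -/

section SchriefferWolff

variable {n k : ℕ}

/-- The sum of the two diagonal blocks. -/
noncomputable def diagPart (n k : ℕ) : Herm n →ₗ[ℝ] Herm n := topPart n k + botPart n k

theorem diagPart_apply (G : Herm n) (a b : Fin n) :
    (diagPart n k G).mat a b = if ((a : ℕ) < k ↔ (b : ℕ) < k) then G.mat a b else 0 := by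
  change (topPart n k G).mat a b + (botPart n k G).mat a b = _
  rw [topPart_apply, botPart_apply]
  by_cases ha : (a : ℕ) < k <;> by_cases hb : (b : ℕ) < k <;>
    simp [ha, hb, not_le.2, not_lt.1]

theorem diagPart_eq (G : Herm n) :
    diagPart n k G = botPart n k G + scalarPart n k G + effPart n k G := by
  rw [effPart_eq, diagPart, LinearMap.add_apply]
  abel

/-- The matrix with the Schrieffer–Wolff decomposition given by the components of `G`. -/
noncomputable def swMap (k : ℕ) (A₀ G : Herm n) : Herm n :=
  expConj (offPart n k G) (A₀ + diagPart n k G)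

/-- The components `(S, B, T, Heff)` of `G`. -/
noncomputable def swParts (k : ℕ) (G : Herm n) : Herm n × Herm n × Herm n × Herm n :=
  (offPart n k G, botPart n k G, scalarPart n k G, effPart n k G)

theorem isSWDecomposition_swMap {A₀ G : Herm n} {μ : ℝ} (hk : 0 < k) (hkn : k ≤ n)
    (h₀ : IsBlockDiag k A₀) (hgap : GershgorinGap k μ (A₀ + diagPart n k G)) :
    IsSWDecomposition k A₀ (swMap k A₀ G) (swParts k G).1 (swParts k G).2.1
      (swParts k G).2.2.1 (swParts k G).2.2.2 where
  decomp := by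
    simp only [swParts, swMap, expConj_mat, diagPart_eq, add_assoc]
  block_B a b h := by
    simp only [swParts, botPart_apply]
    rw [if_neg]
    omega
  scalar_T := by
    refine ⟨(k : ℝ)⁻¹ * reTrace n (topPart n k G), fun a b => ?_⟩
    simp only [swParts, scalarPart_eq, mat_smul, Matrix.smul_apply, topId_apply]
    split_ifs <;> simp
  block_Heff a b h := by
    have h1 : ¬((a : ℕ) < k ∧ (b : ℕ) < k) := by omega
    have h2 : ¬(a = b ∧ (a : ℕ) < k) := by
      rintro ⟨rfl, h⟩; omega
    simp only [swParts, effPart_eq, scalarPart_eq, mat_sub, mat_smul, Matrix.sub_apply,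
      Matrix.smul_apply, topId_apply, topPart_apply, if_neg h1, if_neg h2]
    simp
  trace_Heff := by
    rw [trace_eq_reTrace]
    simp only [swParts, reTrace_effPart hk hkn, Complex.ofReal_zero]
  offBlock_S a b h := by
    simp only [swParts, offPart_apply, if_neg (not_not.2 h)]
  lowest := by
    refine span_col_eq_iSup_eigenspace hkn (D := A₀ + diagPart n k G) ?_ hgap
      (expI_mul_expI_neg _) rfl
    intro a b hab
    rw [mat_add, Matrix.add_apply, diagPart_apply, if_neg hab, h₀ a b hab, add_zero]

/-- The support conditions put the components into complementary subspaces, and the trace separates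
`T` from `Heff`. Hence a decomposition is determined by the sum of its components, which reduces
uniqueness to local injectivity of `swMap`. -/
theorem IsSWDecomposition.swParts_eq {A₀ A S B T Heff : Herm n} (hk : 0 < k) (hkn : k ≤ n)
    (h : IsSWDecomposition k A₀ A S B T Heff) :
    swParts k (S + B + T + Heff) = (S, B, T, Heff) := by
  obtain ⟨c, hc⟩ := h.scalar_T
  have hB := h.block_B
  have hS := h.offBlock_S
  have hE := h.block_Heff
  have hT : T = c • topId n k := by
    ext a b
    rw [hc, mat_smul, Matrix.smul_apply, topId_apply]
    split_ifs <;> simp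
  have hoff : offPart n k (S + B + T + Heff) = S := by
    ext a b
    rw [offPart_apply]
    split_ifs with hab
    · exact (hS a b hab).symm
    · have h1 := hB a b (by omega)
      have h2 := hE a b (by omega)
      have h3 : T.mat a b = 0 := by
        rw [hc, if_neg]; rintro ⟨rfl, h⟩; omega
      simp [h1, h2, h3]
  have hbot : botPart n k (S + B + T + Heff) = B := by
    ext a b
    rw [botPart_apply]
    split_ifs with hab
    · have h1 := hS a b (by omega)
      have h2 := hE a b (by omega)
      have h3 : T.mat a b = 0 := by
        rw [hc, if_neg]; rintro ⟨rfl, h⟩; omega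
      simp [h1, h2, h3]
    · exact (hB a b (by omega)).symm
  have htop : topPart n k (S + B + T + Heff) = T + Heff := by
    ext a b
    rw [topPart_apply]
    split_ifs with hab
    · have h1 := hS a b (by omega)
      have h2 := hB a b (by omega)
      simp [h1, h2]
    · have h2 := hE a b (by omega)
      have h3 : T.mat a b = 0 := by
        rw [hc, if_neg]; rintro ⟨rfl, h⟩; omega
      simp [h2, h3]
  have htr : reTrace n Heff = 0 := by
    have := h.trace_Heff
    rw [trace_eq_reTrace] at this
    exact_mod_cast this
  have hsc : scalarPart n k (S + B + T + Heff) = T := by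
    have : (k : ℝ) ≠ 0 := by positivity
    rw [scalarPart_eq, htop, map_add, htr, hT, map_smul, reTrace_topId hkn, smul_eq_mul, add_zero]
    congr 1
    field_simp
  rw [swParts, effPart_eq, hoff, hbot, hsc, htop, add_sub_cancel_left]

theorem IsSWDecomposition.eq_swMap {A₀ A S B T Heff : Herm n} (hk : 0 < k) (hkn : k ≤ n)
    (h : IsSWDecomposition k A₀ A S B T Heff) : A = swMap k A₀ (S + B + T + Heff) := by
  have hp := h.swParts_eq hk hkn
  simp only [swParts, Prod.mk.injEq] at hp
  obtain ⟨h1, h2, h3, h4⟩ := hp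
  refine mat_injective ?_
  rw [h.decomp, swMap, expConj_mat, diagPart_eq, h1, h2, h3, h4]
  simp only [add_assoc]

section Smooth

attribute [local instance] Matrix.linftyOpNormedRing Matrix.linftyOpNormedAlgebra

/-- `hermPart` is a linear retraction onto the Hermitian matrices, so a subtype-valued map becomes a
linear image of a formula in the Banach algebra of all matrices. The operator norm is needed only to
make that algebra normed. -/
theorem swMap_eq (A₀ G : Herm n) : swMap k A₀ G =
    hermPart n (NormedSpace.exp (Complex.I • (offPart n k G).mat) *
      (A₀.mat + (diagPart n k G).mat) * NormedSpace.exp (-(Complex.I • (offPart n k G).mat))) := by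
  rw [← hermPart_mat (swMap k A₀ G), swMap, expConj_mat, expI, expI, mat_neg, smul_neg, mat_add]

/-- `G ↦ i S` for the component `S` of `G`. -/
noncomputable def iOffPart (n k : ℕ) : Herm n →ₗ[ℝ] Matrix (Fin n) (Fin n) ℂ where
  toFun G := Complex.I • (offPart n k G).mat
  map_add' G K := by rw [map_add, mat_add, smul_add]
  map_smul' c G := by rw [map_smul, mat_smul, smul_comm]; rfl

theorem contDiff_swMap (k : ℕ) (A₀ : Herm n) : ContDiff ℝ ∞ (swMap k A₀) := by
  have := contDiff_exp_conj (hermPart n).toContinuousLinearMap (iOffPart n k).toContinuousLinearMap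
    ((matₗ n).comp (diagPart n k)).toContinuousLinearMap A₀.mat
  rw [funext (swMap_eq (k := k) A₀)]
  exact this

/-- The linearization of `swMap k A₀` at `0`. -/
noncomputable def swDeriv (k : ℕ) (A₀ : Herm n) : Herm n →ₗ[ℝ] Herm n :=
  (hermPart n).comp ((LinearMap.mulRight ℝ A₀.mat).comp (iOffPart n k) +
    (matₗ n).comp (diagPart n k) - (LinearMap.mulLeft ℝ A₀.mat).comp (iOffPart n k))

theorem hasFDerivAt_swMap (k : ℕ) (A₀ : Herm n) :
    HasFDerivAt (swMap k A₀) (swDeriv k A₀).toContinuousLinearMap 0 := by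
  have := hasFDerivAt_exp_conj (hermPart n).toContinuousLinearMap
    (iOffPart n k).toContinuousLinearMap
    ((matₗ n).comp (diagPart n k)).toContinuousLinearMap A₀.mat
    (swDeriv k A₀).toContinuousLinearMap (fun x => rfl)
  rw [funext (swMap_eq (k := k) A₀)]
  exact this

end Smooth

theorem swDeriv_mat (A₀ G : Herm n) : (swDeriv k A₀ G).mat =
    Complex.I • (offPart n k G).mat * A₀.mat + (diagPart n k G).mat -
      A₀.mat * (Complex.I • (offPart n k G).mat) := by
  set X := Complex.I • (offPart n k G).mat * A₀.mat + (diagPart n k G).mat -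
      A₀.mat * (Complex.I • (offPart n k G).mat) with hX
  -- The commutator `i [S, A₀]` of Hermitian matrices is Hermitian, so `hermPart` acts trivially.
  have hstar : star X = X := by
    rw [hX]
    simp only [star_sub, star_add, star_mul, star_smul, star_mat]
    simp
    abel
  have : swDeriv k A₀ G = hermPart n X := rfl
  rw [this]
  change (2⁻¹ : ℝ) • (X + star X) = X
  rw [hstar, ← two_smul ℝ X, smul_smul]; norm_num

theorem swDeriv_apply {A₀ : Herm n} {d : Fin n → ℝ}
    (h₀ : A₀.mat = Matrix.diagonal fun i => (d i : ℂ)) (G : Herm n) (a b : Fin n) :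
    (swDeriv k A₀ G).mat a b =
      if ((a : ℕ) < k ↔ (b : ℕ) < k) then G.mat a b
      else Complex.I * (d b - d a) * G.mat a b := by
  rw [swDeriv_mat, h₀]
  simp only [Matrix.sub_apply, Matrix.add_apply, Matrix.mul_diagonal, Matrix.diagonal_mul,
    Matrix.smul_apply, offPart_apply, diagPart_apply, smul_eq_mul]
  split_ifs
  · simp
  · ring

/-- The linearization acts entrywise, and the factor of an off-block entry is a difference of
diagonal entries of `A₀` on opposite sides of the gap. -/
theorem swDeriv_injective {A₀ : Herm n} {d : Fin n → ℝ}
    (h₀ : A₀.mat = Matrix.diagonal fun i => (d i : ℂ))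
    (hd : ∀ a b : Fin n, (a : ℕ) < k → k ≤ (b : ℕ) → d a < d b) :
    Function.Injective (swDeriv k A₀) := by
  rw [← LinearMap.ker_eq_bot, LinearMap.ker_eq_bot']
  intro G hG
  ext a b
  have h := swDeriv_apply (k := k) h₀ G a b
  rw [hG, mat_zero, Matrix.zero_apply] at h
  rw [mat_zero, Matrix.zero_apply]
  split_ifs at h with hab
  · exact h.symm
  · have hne : ((d b : ℂ) - d a) ≠ 0 := by
      rw [sub_ne_zero]
      norm_cast
      rcases lt_or_ge (a : ℕ) k with ha | ha
      · exact (hd a b ha (by omega)).ne'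
      · exact (hd b a (by omega) ha).ne
    simpa [Complex.I_ne_zero, hne] using h.symm

/-- The linearization of `swMap k A₀` at `0`, for a diagonal matrix `A₀` with a gap. -/
noncomputable def swDerivEquiv {A₀ : Herm n} {d : Fin n → ℝ}
    (h₀ : A₀.mat = Matrix.diagonal fun i => (d i : ℂ))
    (hd : ∀ a b : Fin n, (a : ℕ) < k → k ≤ (b : ℕ) → d a < d b) : Herm n ≃L[ℝ] Herm n :=
  (LinearEquiv.ofInjectiveEndo (swDeriv k A₀) (swDeriv_injective h₀ hd)).toContinuousLinearEquiv

theorem swDerivEquiv_apply {A₀ : Herm n} {d : Fin n → ℝ}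
    (h₀ : A₀.mat = Matrix.diagonal fun i => (d i : ℂ))
    (hd : ∀ a b : Fin n, (a : ℕ) < k → k ≤ (b : ℕ) → d a < d b) (G : Herm n) :
    swDerivEquiv h₀ hd G = swDeriv k A₀ G := rfl

theorem hasFDerivAt_swMap_equiv {A₀ : Herm n} {d : Fin n → ℝ}
    (h₀ : A₀.mat = Matrix.diagonal fun i => (d i : ℂ))
    (hd : ∀ a b : Fin n, (a : ℕ) < k → k ≤ (b : ℕ) → d a < d b) :
    HasFDerivAt (swMap k A₀) (swDerivEquiv h₀ hd : Herm n →L[ℝ] Herm n) 0 :=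
  (hasFDerivAt_swMap k A₀).congr_fderiv rfl

theorem swMap_zero (A₀ : Herm n) : swMap k A₀ 0 = A₀ := by
  refine mat_injective ?_
  simp [swMap, expConj_mat, expI, NormedSpace.exp_zero]

theorem isBlockDiag_of_diagonal {A₀ : Herm n} {d : Fin n → ℝ}
    (h₀ : A₀.mat = Matrix.diagonal fun i => (d i : ℂ)) : IsBlockDiag k A₀ := by
  intro a b hab
  rw [h₀, Matrix.diagonal_apply_ne]
  rintro rfl
  exact hab Iff.rfl

theorem isBlockDiag_add_diagPart {A₀ : Herm n} (h₀ : IsBlockDiag k A₀) (G : Herm n) :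
    IsBlockDiag k (A₀ + diagPart n k G) := by
  intro a b hab
  rw [mat_add, Matrix.add_apply, diagPart_apply, if_neg hab, h₀ a b hab, add_zero]

theorem continuous_entry (a b : Fin n) : Continuous fun A : Herm n => A.mat a b :=
  LinearMap.continuous_of_finiteDimensional
    ({ toFun := fun A => A.mat a b
       map_add' := fun _ _ => rfl
       map_smul' := fun _ _ => rfl } : Herm n →ₗ[ℝ] ℂ)

theorem eventually_gershgorinGap {A₀ : Herm n} {d : Fin n → ℝ} {μ : ℝ}
    (h₀ : A₀.mat = Matrix.diagonal fun i => (d i : ℂ))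
    (hlo : ∀ a : Fin n, (a : ℕ) < k → d a < μ) (hhi : ∀ a : Fin n, k ≤ (a : ℕ) → μ < d a) :
    ∀ᶠ A in 𝓝 A₀, GershgorinGap k μ A := by
  have hsum : ∀ a, ∑ b ∈ Finset.univ.erase a, ‖A₀.mat a b‖ = 0 := fun a =>
    Finset.sum_eq_zero fun b hb => by
      rw [h₀, Matrix.diagonal_apply_ne _ (Finset.ne_of_mem_erase hb).symm, norm_zero]
  have hre : ∀ a, (A₀.mat a a).re = d a := fun a => by simp [h₀]
  have hc1 : ∀ a : Fin n, Continuous fun A : Herm n => (A.mat a a).re :=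
    fun a => Complex.continuous_re.comp (continuous_entry a a)
  have hc2 : ∀ a : Fin n, Continuous fun A : Herm n => ∑ b ∈ Finset.univ.erase a, ‖A.mat a b‖ :=
    fun a => continuous_finsetSum _ fun b _ => (continuous_entry a b).norm
  refine Filter.Eventually.and ?_ ?_
  · refine Filter.eventually_all.2 fun a => ?_
    by_cases ha : (a : ℕ) < k
    · filter_upwards [((hc1 a).add (hc2 a)).continuousAt.eventually_lt continuousAt_const
        (show (A₀.mat a a).re + _ < μ by
          beta_reduce; rw [hsum, hre, add_zero]; exact hlo a ha)] with A hA _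
      exact hA
    · exact Filter.Eventually.of_forall fun _ h => absurd h ha
  · refine Filter.eventually_all.2 fun a => ?_
    by_cases ha : k ≤ (a : ℕ)
    · filter_upwards [continuousAt_const.eventually_lt ((hc1 a).sub (hc2 a)).continuousAt
        (show μ < (A₀.mat a a).re - _ by
          beta_reduce; rw [hsum, hre, sub_zero]; exact hhi a ha)] with A hA _
      exact hA
    · exact Filter.Eventually.of_forall fun _ h => absurd h ha

theorem eventually_gershgorinGap_diagPart {A₀ : Herm n} {d : Fin n → ℝ} {μ : ℝ}
    (h₀ : A₀.mat = Matrix.diagonal fun i => (d i : ℂ))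
    (hlo : ∀ a : Fin n, (a : ℕ) < k → d a < μ) (hhi : ∀ a : Fin n, k ≤ (a : ℕ) → μ < d a) :
    ∀ᶠ G in 𝓝 (0 : Herm n), GershgorinGap k μ (A₀ + diagPart n k G) := by
  have hc : Continuous fun G : Herm n => A₀ + diagPart n k G :=
    continuous_const.add (LinearMap.continuous_of_finiteDimensional (diagPart n k))
  have h1 := hc.tendsto 0
  simp only [map_zero, add_zero] at h1
  exact h1.eventually (eventually_gershgorinGap h₀ hlo hhi)

theorem continuous_swParts : Continuous (swParts k : Herm n → _) := by
  have h : ∀ f : Herm n →ₗ[ℝ] Herm n, Continuous f :=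
    fun f => LinearMap.continuous_of_finiteDimensional f
  exact (h _).prodMk ((h _).prodMk ((h _).prodMk (h _)))

/-- Near a diagonal matrix with a gap, the effective Hamiltonian is obtained from a smooth local
inverse of `swMap`. -/
theorem exists_localInverse_swMap {A₀ : Herm n} {d : Fin n → ℝ} {μ : ℝ} (hk : 0 < k) (hkn : k ≤ n)
    (h₀ : A₀.mat = Matrix.diagonal fun i => (d i : ℂ))
    (hlo : ∀ a : Fin n, (a : ℕ) < k → d a < μ) (hhi : ∀ a : Fin n, k ≤ (a : ℕ) → μ < d a) :
    ∃ g : Herm n → Herm n, ContDiffAt ℝ ∞ g A₀ ∧ g A₀ = 0 ∧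
      (∀ᶠ A in 𝓝 A₀, swMap k A₀ (g A) = A) ∧
      (∀ᶠ G in 𝓝 (0 : Herm n), g (swMap k A₀ G) = G) ∧
      (∀ᶠ A in 𝓝 A₀, effectiveHamiltonian k A₀ A = effPart n k (g A)) := by
  have hd : ∀ a b : Fin n, (a : ℕ) < k → k ≤ (b : ℕ) → d a < d b :=
    fun a b ha hb => (hlo a ha).trans (hhi b hb)
  have hsm : ContDiffAt ℝ ∞ (swMap k A₀) 0 := (contDiff_swMap k A₀).contDiffAt
  have hder := hasFDerivAt_swMap_equiv h₀ hd
  have hn : (∞ : WithTop ℕ∞) ≠ 0 := by simp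
  let Φ := hsm.toOpenPartialHomeomorph (swMap k A₀) hder hn
  have hΦ : ∀ G, Φ G = swMap k A₀ G := fun _ => rfl
  have h0s : (0 : Herm n) ∈ Φ.source := hsm.mem_toOpenPartialHomeomorph_source hder hn
  have h0t : A₀ ∈ Φ.target := by
    have := hsm.image_mem_toOpenPartialHomeomorph_target hder hn
    rwa [swMap_zero] at this
  have hg0 : Φ.symm A₀ = 0 := by
    have := Φ.left_inv h0s
    rwa [hΦ, swMap_zero] at this
  have hgs : ContDiffAt ℝ ∞ Φ.symm A₀ := by
    have := hsm.to_localInverse hder hn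
    rwa [swMap_zero] at this
  have hright : ∀ᶠ A in 𝓝 A₀, swMap k A₀ (Φ.symm A) = A := by
    filter_upwards [Φ.open_target.mem_nhds h0t] with A hA using Φ.right_inv hA
  have hleft : ∀ᶠ G in 𝓝 (0 : Herm n), Φ.symm (swMap k A₀ G) = G := by
    filter_upwards [Φ.open_source.mem_nhds h0s] with G hG using Φ.left_inv hG
  have hgt : Filter.Tendsto Φ.symm (𝓝 A₀) (𝓝 0) := by
    have := hgs.continuousAt.tendsto
    rwa [hg0] at this
  have hgap := eventually_gershgorinGap_diagPart h₀ hlo hhi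
  have hsw : ∀ᶠ A in 𝓝 A₀, IsSWDecomposition k A₀ A (swParts k (Φ.symm A)).1
      (swParts k (Φ.symm A)).2.1 (swParts k (Φ.symm A)).2.2.1 (swParts k (Φ.symm A)).2.2.2 := by
    filter_upwards [hright, hgt.eventually hgap] with A h1 h2
    have := isSWDecomposition_swMap hk hkn (isBlockDiag_of_diagonal h₀) h2
    rwa [h1] at this
  have hparts0 : swParts k (0 : Herm n) = 0 := by simp [swParts]
  have hnb : IsSWNeighborhoods k A₀ (swNeighborhoods k A₀).1 (swNeighborhoods k A₀).2 := by
    have hex : ∃ q : Set (Herm n) × Set (Herm n × Herm n × Herm n × Herm n),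
        IsSWNeighborhoods k A₀ q.1 q.2 := by
      -- The second set consists of the quadruples whose sum lies where `Φ` is injective; this makes
      -- the decomposition unique there.
      refine ⟨({A | IsSWDecomposition k A₀ A (swParts k (Φ.symm A)).1 (swParts k (Φ.symm A)).2.1
          (swParts k (Φ.symm A)).2.2.1 (swParts k (Φ.symm A)).2.2.2} ∩ Φ.target,
          {q | q.1 + q.2.1 + q.2.2.1 + q.2.2.2 ∈ Φ.source}),
        Filter.inter_mem hsw (Φ.open_target.mem_nhds h0t), ?_, ?_⟩
      · have hc : Continuous fun q : Herm n × Herm n × Herm n × Herm n =>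
            q.1 + q.2.1 + q.2.2.1 + q.2.2.2 := by fun_prop
        refine hc.continuousAt.preimage_mem_nhds (Φ.open_source.mem_nhds ?_)
        simpa using h0s
      · rintro A ⟨hA, hAt⟩
        refine ⟨swParts k (Φ.symm A), ⟨?_, hA⟩, ?_⟩
        · change offPart n k (Φ.symm A) + botPart n k (Φ.symm A) + scalarPart n k (Φ.symm A) +
            effPart n k (Φ.symm A) ∈ Φ.source
          rw [parts_add]
          exact Φ.map_target hAt
        · rintro ⟨S, B, T, K⟩ ⟨hq, hq2⟩
          have h1 := hq2.eq_swMap hk hkn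
          have h2 := hq2.swParts_eq hk hkn
          change S + B + T + K ∈ Φ.source at hq
          have h3 := Φ.left_inv hq
          rw [hΦ] at h3
          rw [h1, h3, h2]
    exact Classical.epsilon_spec hex
  refine ⟨Φ.symm, hgs, hg0, hright, hleft, ?_⟩
  -- The neighbourhoods fixed by choice need not be those built above. By continuity the constructed
  -- decomposition lies in the chosen set for `A` near `A₀`, and uniqueness there identifies it with
  -- the chosen one.
  have hX : ∀ᶠ A in 𝓝 A₀, swParts k (Φ.symm A) ∈ (swNeighborhoods k A₀).2 := by
    have := (continuous_swParts (k := k) (n := n)).tendsto 0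
    rw [hparts0] at this
    exact (this.comp hgt).eventually hnb.2.1
  filter_upwards [hnb.1, hX, hsw] with A hAV hAX hAs
  obtain ⟨q, -, hq⟩ := hnb.2.2 A hAV
  have hspec : ∃ q : Herm n × Herm n × Herm n × Herm n,
    q ∈ (swNeighborhoods k A₀).2 ∧ IsSWDecomposition k A₀ A q.1 q.2.1 q.2.2.1 q.2.2.2 :=
    ⟨_, hAX, hAs⟩
  have h1 := hq _ (Classical.epsilon_spec hspec)
  have h2 := hq _ ⟨hAX, hAs⟩
  rw [effectiveHamiltonian, h1, ← h2]
  rfl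

end SchriefferWolff

/-! ### Pauli coordinates of the upper left block -/

section Pauli

variable {n m : ℕ}

/-- The coordinates in the Pauli basis, as a linear map. -/
noncomputable def pauliCoordₗ (n : ℕ) : Herm n →ₗ[ℝ] EuclideanSpace ℝ (Fin 3) where
  toFun := pauliCoord
  map_add' A B := by
    ext j
    simp [pauliCoord, mul_add]
  map_smul' c A := by
    ext j
    simp [pauliCoord]

theorem trace_embedTwo_mul (P : Matrix (Fin 2) (Fin 2) ℂ) (A : Herm (2 + m)) :
    Matrix.trace (embedTwo (2 + m) P * A.mat) = Matrix.trace (P * A.topBlock.mat) := by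
  have h1 : ∀ i j : Fin 2, embedTwo (2 + m) P (Fin.castAdd m i) (Fin.castAdd m j) = P i j :=
    fun i j => dif_pos ⟨i.2, j.2⟩
  have h2 : ∀ (i : Fin 2) (j : Fin m),
      embedTwo (2 + m) P (Fin.castAdd m i) (Fin.natAdd 2 j) = 0 :=
    fun i j => dif_neg (by rw [Fin.val_natAdd]; omega)
  have h3 : ∀ (i : Fin m) (j : Fin (2 + m)), embedTwo (2 + m) P (Fin.natAdd 2 i) j = 0 :=
    fun i j => dif_neg (by rw [Fin.val_natAdd]; omega)
  simp only [Matrix.trace, Matrix.diag_apply, Matrix.mul_apply]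
  rw [Fin.sum_univ_add]
  simp only [h3, zero_mul, Finset.sum_const_zero, add_zero]
  refine Finset.sum_congr rfl fun i _ => ?_
  rw [Fin.sum_univ_add]
  simp only [h1, h2, zero_mul, Finset.sum_const_zero, add_zero, topBlock_apply]

theorem pauliCoord_zero (A : Herm (2 + m)) : pauliCoord A 0 = √2 * (A.topBlock.mat 0 1).re := by
  have h10 : A.topBlock.mat 1 0 = star (A.topBlock.mat 0 1) :=
    (A.topBlock.isHermitian.apply 1 0).symm
  change (Matrix.trace (embedTwo (2 + m) (pauli 0) * A.mat)).re = _
  rw [trace_embedTwo_mul]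
  -- An opaque `r` keeps `simp` from rewriting the normalizing factor.
  obtain ⟨r, hr⟩ : ∃ r, r = (√2)⁻¹ := ⟨_, rfl⟩
  have h2 : r * 2 = √2 := by
    rw [hr, inv_mul_eq_div, Real.div_sqrt]
  simp only [Matrix.trace, Fin.sum_univ_two, Matrix.diag_apply, Matrix.mul_apply, pauli, h10, ← hr]
  simp [-topBlock_apply]
  linear_combination (A.topBlock.mat 0 1).re * h2

theorem pauliCoord_one (A : Herm (2 + m)) : pauliCoord A 1 = -√2 * (A.topBlock.mat 0 1).im := by
  have h10 : A.topBlock.mat 1 0 = star (A.topBlock.mat 0 1) :=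
    (A.topBlock.isHermitian.apply 1 0).symm
  change (Matrix.trace (embedTwo (2 + m) (pauli 1) * A.mat)).re = _
  rw [trace_embedTwo_mul]
  obtain ⟨r, hr⟩ : ∃ r, r = (√2)⁻¹ := ⟨_, rfl⟩
  have h2 : r * 2 = √2 := by
    rw [hr, inv_mul_eq_div, Real.div_sqrt]
  simp only [Matrix.trace, Fin.sum_univ_two, Matrix.diag_apply, Matrix.mul_apply, pauli, h10, ← hr]
  simp [-topBlock_apply]
  linear_combination -(A.topBlock.mat 0 1).im * h2

theorem pauliCoord_two (A : Herm (2 + m)) :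
    pauliCoord A 2 = (√2)⁻¹ * ((A.topBlock.mat 0 0).re - (A.topBlock.mat 1 1).re) := by
  change (Matrix.trace (embedTwo (2 + m) (pauli 2) * A.mat)).re = _
  rw [trace_embedTwo_mul]
  obtain ⟨r, hr⟩ : ∃ r, r = (√2)⁻¹ := ⟨_, rfl⟩
  simp only [Matrix.trace, Fin.sum_univ_two, Matrix.diag_apply, Matrix.mul_apply, pauli, ← hr]
  simp
  ring

theorem norm_sq_pauliCoord (A : Herm (2 + m)) : 2 * ‖pauliCoord A‖ ^ 2 =
    ((A.topBlock.mat 0 0).re - (A.topBlock.mat 1 1).re) ^ 2 + 4 * ‖A.topBlock.mat 0 1‖ ^ 2 := by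
  rw [EuclideanSpace.norm_sq_eq, Fin.sum_univ_three, pauliCoord_zero, pauliCoord_one,
    pauliCoord_two, ← Complex.normSq_eq_norm_sq (A.topBlock.mat 0 1), Complex.normSq_apply]
  simp only [Real.norm_eq_abs, sq_abs, mul_pow, neg_sq, inv_pow,
    Real.sq_sqrt (zero_le_two : (0 : ℝ) ≤ 2)]
  ring

/-- The coordinates see neither the other blocks nor a scalar shift of the upper left one. Therefore
neither the scalar part of `G` nor the degenerate block of `A₀` contributes below. -/
theorem pauliCoord_eq_of_topBlock {A B : Herm (2 + m)}
    (h01 : A.topBlock.mat 0 1 = B.topBlock.mat 0 1)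
    (hd : A.topBlock.mat 0 0 - A.topBlock.mat 1 1 = B.topBlock.mat 0 0 - B.topBlock.mat 1 1) :
    pauliCoord A = pauliCoord B := by
  have hd' := congrArg Complex.re hd
  rw [Complex.sub_re, Complex.sub_re] at hd'
  ext j
  fin_cases j
  · simp only [Fin.zero_eta, pauliCoord_zero, h01]
  · simp only [Fin.mk_one, pauliCoord_one, h01]
  · simp only [Fin.reduceFinMk, pauliCoord_two, hd']

theorem topBlock_scalarPart (G : Herm (2 + m)) : ∃ c : ℝ, ∀ i j : Fin 2,
    (scalarPart (2 + m) 2 G).topBlock.mat i j = if i = j then (c : ℂ) else 0 := by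
  refine ⟨((2 : ℕ) : ℝ)⁻¹ * reTrace (2 + m) (topPart (2 + m) 2 G), fun i j => ?_⟩
  rw [topBlock_apply, scalarPart_eq, mat_smul, Matrix.smul_apply, topId_apply]
  simp only [Fin.castAdd_inj, Fin.val_castAdd, i.2, and_true, smul_ite, smul_zero]
  simp only [Complex.real_smul, mul_one]

theorem topBlock_effPart (G : Herm (2 + m)) (i j : Fin 2) :
    (effPart (2 + m) 2 G).topBlock.mat i j =
      G.topBlock.mat i j - (scalarPart (2 + m) 2 G).topBlock.mat i j := by
  rw [topBlock_apply, effPart_eq, mat_sub, Matrix.sub_apply, topPart_apply,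
    if_pos ⟨i.2, j.2⟩, topBlock_apply, topBlock_apply]

theorem pauliCoord_effPart (G : Herm (2 + m)) :
    pauliCoord (effPart (2 + m) 2 G) = pauliCoord G := by
  obtain ⟨c, hc⟩ := topBlock_scalarPart G
  apply pauliCoord_eq_of_topBlock
  · rw [topBlock_effPart, hc]; simp
  · rw [topBlock_effPart, topBlock_effPart, hc, hc]; simp

theorem pauliCoord_add_diagPart {A₀ : Herm (2 + m)} {d : Fin (2 + m) → ℝ}
    (h₀ : A₀.mat = Matrix.diagonal fun i => (d i : ℂ))
    (htop : d (Fin.castAdd m 0) = d (Fin.castAdd m 1)) (G : Herm (2 + m)) :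
    pauliCoord (A₀ + diagPart (2 + m) 2 G) = pauliCoord G := by
  have h : ∀ i j : Fin 2, (A₀ + diagPart (2 + m) 2 G).topBlock.mat i j =
      (if i = j then (d (Fin.castAdd m 0) : ℂ) else 0) + G.topBlock.mat i j := by
    intro i j
    rw [topBlock_apply, mat_add, Matrix.add_apply, diagPart_apply, 
      if_pos (show (Fin.castAdd m i : ℕ) < 2 ↔ (Fin.castAdd m j : ℕ) < 2 from iff_of_true i.2 j.2),
     
      topBlock_apply, h₀, Matrix.diagonal_apply]
    simp only [Fin.castAdd_inj]
    congr 1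
    fin_cases i <;> simp [htop]
  apply pauliCoord_eq_of_topBlock
  · rw [h]; simp
  · rw [h, h]; simp

theorem pauliCoord_surjective : Function.Surjective (pauliCoord : Herm (2 + m) → _) := by
  intro y
  -- The combination of the matrices `pauli j` with coefficients `y j`, extended by zero.
  let X : Matrix (Fin (2 + m)) (Fin (2 + m)) ℂ := Matrix.of fun a b =>
    if (a : ℕ) = 0 ∧ (b : ℕ) = 0 then ((√2)⁻¹ * y 2 : ℝ)
    else if (a : ℕ) = 1 ∧ (b : ℕ) = 1 then (-((√2)⁻¹ * y 2) : ℝ)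
    else if (a : ℕ) = 0 ∧ (b : ℕ) = 1 then ⟨(√2)⁻¹ * y 0, -((√2)⁻¹ * y 1)⟩
    else if (a : ℕ) = 1 ∧ (b : ℕ) = 0 then ⟨(√2)⁻¹ * y 0, (√2)⁻¹ * y 1⟩
    else 0
  have hX : star X = X := by
    ext a b
    simp only [X, Matrix.star_apply, Matrix.of_apply]
    split_ifs <;> first | omega | (apply Complex.ext <;> simp)
  have hs : √2 * (√2)⁻¹ = 1 := mul_inv_cancel₀ (by positivity)
  have hs2 : (√2)⁻¹ * (√2)⁻¹ * 2 = 1 := by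
    rw [← mul_inv, Real.mul_self_sqrt zero_le_two]; norm_num
  let A : Herm (2 + m) := ⟨X, hX⟩
  refine ⟨A, ?_⟩
  have h01 : A.topBlock.mat 0 1 = ⟨(√2)⁻¹ * y 0, -((√2)⁻¹ * y 1)⟩ := by
    change X (Fin.castAdd m 0) (Fin.castAdd m 1) = _
    simp only [X, Matrix.of_apply, Fin.val_castAdd]
    simp
  have h00 : A.topBlock.mat 0 0 = ((√2)⁻¹ * y 2 : ℝ) := by
    change X (Fin.castAdd m 0) (Fin.castAdd m 0) = _
    simp only [X, Matrix.of_apply, Fin.val_castAdd]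
    simp
  have h11 : A.topBlock.mat 1 1 = (-((√2)⁻¹ * y 2) : ℝ) := by
    change X (Fin.castAdd m 1) (Fin.castAdd m 1) = _
    simp only [X, Matrix.of_apply, Fin.val_castAdd]
    simp
  ext j
  fin_cases j
  · simp only [Fin.zero_eta, pauliCoord_zero, h01]
    linear_combination y 0 * hs
  · simp only [Fin.mk_one, pauliCoord_one, h01]
    linear_combination y 1 * hs
  · simp only [Fin.reduceFinMk, pauliCoord_two, h00, h11, Complex.ofReal_re]
    linear_combination y 2 * hs2

end Pauli

/-! ### The local defining map of `Σ₂` -/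

section Splitting

variable {m : ℕ} {A₀ : Herm (2 + m)} {d : Fin (2 + m) → ℝ} {μ : ℝ}

theorem charpoly_swMap {n k : ℕ} (A₀ G : Herm n) :
    (swMap k A₀ G).mat.charpoly = (A₀ + diagPart n k G).mat.charpoly :=
  charpoly_eq_of_conj (expI_mul_expI_neg (offPart n k G)) rfl

/-- Conjugation preserves the spectrum, so the splitting is read off the upper block of `A₀ +
diagPart G`. That of `A₀` is scalar by `htop`, and the discriminant of the rest is `2 ‖pauliCoord G‖
^ 2`. -/
theorem stdDevEig_swMap (h₀ : A₀.mat = Matrix.diagonal fun i => (d i : ℂ))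
    (htop : d (Fin.castAdd m 0) = d (Fin.castAdd m 1)) {G : Herm (2 + m)}
    (hG : GershgorinGap 2 μ (A₀ + diagPart (2 + m) 2 G)) :
    stdDevEig 2 (swMap 2 A₀ G) = ‖pauliCoord G‖ / √2 := by
  have hD := isBlockDiag_add_diagPart (isBlockDiag_of_diagonal (k := 2) h₀) G
  have h1 := sq_stdDevEig_two hD hG (charpoly_swMap A₀ G)
  rw [← norm_sq_pauliCoord, pauliCoord_add_diagPart h₀ htop] at h1
  have h2 : 0 ≤ stdDevEig 2 (swMap 2 A₀ G) := Real.sqrt_nonneg _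
  rw [← sq_eq_sq₀ h2 (by positivity), div_pow, Real.sq_sqrt zero_le_two]
  linarith

theorem swMap_mem_SigmaSet_iff (h₀ : A₀.mat = Matrix.diagonal fun i => (d i : ℂ))
    (htop : d (Fin.castAdd m 0) = d (Fin.castAdd m 1)) {G : Herm (2 + m)}
    (hG : GershgorinGap 2 μ (A₀ + diagPart (2 + m) 2 G)) :
    swMap 2 A₀ G ∈ SigmaSet 2 (2 + m) ↔ pauliCoord G = 0 := by
  have hD := isBlockDiag_add_diagPart (isBlockDiag_of_diagonal (k := 2) h₀) G
  rw [mem_SigmaSet_two_iff hD hG (charpoly_swMap A₀ G), stdDevEig_swMap h₀ htop hG]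
  simp

/-- The properties of the local defining map of `Σ₂` near `A₀` given by the effective
Hamiltonian. -/
structure IsSplittingMap {n : ℕ} (Ψ : Herm n → EuclideanSpace ℝ (Fin 3)) (A₀ : Herm n) :
    Prop where
  map_base : Ψ A₀ = 0
  contDiffAt : ContDiffAt ℝ ∞ Ψ A₀
  stdDevEig_eq : ∀ᶠ A in 𝓝 A₀, stdDevEig 2 A = ‖Ψ A‖ / √2
  fderiv_surjective : Function.Surjective (fderiv ℝ Ψ A₀)
  mem_tangentVectors_iff : ∀ v, v ∈ tangentVectors (SigmaSet 2 n) A₀ ↔ fderiv ℝ Ψ A₀ v = 0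

/-- In the coordinate `G = g A` the map is the linear surjection `pauliCoord`, and `Σ₂` is its
kernel; every property follows by transport along the local diffeomorphism `swMap`. -/
theorem isSplittingMap_effectiveHamiltonian
    (h₀ : A₀.mat = Matrix.diagonal fun i => (d i : ℂ))
    (hlo : ∀ a : Fin (2 + m), (a : ℕ) < 2 → d a < μ)
    (hhi : ∀ a : Fin (2 + m), 2 ≤ (a : ℕ) → μ < d a)
    (htop : d (Fin.castAdd m 0) = d (Fin.castAdd m 1)) :
    IsSplittingMap (fun A => pauliCoord (effectiveHamiltonian 2 A₀ A)) A₀ := by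
  obtain ⟨g, hgs, hg0, hright, hleft, heff⟩ :=
    exists_localInverse_swMap two_pos (by omega) h₀ hlo hhi
  have hgt : Filter.Tendsto g (𝓝 A₀) (𝓝 0) := by
    have := hgs.continuousAt.tendsto
    rwa [hg0] at this
  have hgap := eventually_gershgorinGap_diagPart h₀ hlo hhi
  set Ψ : Herm (2 + m) → EuclideanSpace ℝ (Fin 3) :=
    fun A => pauliCoord (effectiveHamiltonian 2 A₀ A) with hΨ
  have hΨg : Ψ =ᶠ[𝓝 A₀] fun A => pauliCoord (g A) := by
    filter_upwards [heff] with A hA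
    simp only [hΨ, hA, pauliCoord_effPart]
  let c : Herm (2 + m) →L[ℝ] EuclideanSpace ℝ (Fin 3) := (pauliCoordₗ (2 + m)).toContinuousLinearMap
  have hc : ∀ G, c G = pauliCoord G := fun _ => rfl
  have hsmooth : ContDiffAt ℝ ∞ Ψ A₀ :=
    (c.contDiff.contDiffAt.comp A₀ hgs).congr_of_eventuallyEq hΨg
  have hstd : ∀ᶠ A in 𝓝 A₀, stdDevEig 2 A = ‖Ψ A‖ / √2 := by
    filter_upwards [hΨg, hright, hgt.eventually hgap] with A h1 h2 h3
    have := stdDevEig_swMap h₀ htop h3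
    rwa [h2, ← h1] at this
  have hmem : ∀ᶠ A in 𝓝 A₀, A ∈ SigmaSet 2 (2 + m) ↔ Ψ A = 0 := by
    filter_upwards [hΨg, hright, hgt.eventually hgap] with A h1 h2 h3
    have := swMap_mem_SigmaSet_iff h₀ htop h3
    rwa [h2, ← h1] at this
  have hd : ∀ a b : Fin (2 + m), (a : ℕ) < 2 → 2 ≤ (b : ℕ) → d a < d b :=
    fun a b ha hb => (hlo a ha).trans (hhi b hb)
  have hswt : Filter.Tendsto (swMap 2 A₀) (𝓝 0) (𝓝 A₀) := by
    have := (contDiff_swMap 2 A₀).continuous.tendsto 0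
    rwa [swMap_zero] at this
  -- Near `0` the composite `Ψ ∘ swMap` is the linear map `c`; its derivative is computed in two
  -- ways.
  have hder : ∀ G, fderiv ℝ Ψ A₀ (swDeriv 2 A₀ G) = pauliCoord G := by
    have h1 : HasFDerivAt (fun G => Ψ (swMap 2 A₀ G))
        ((fderiv ℝ Ψ A₀).comp (swDeriv 2 A₀).toContinuousLinearMap) 0 := by
      have h := (hsmooth.differentiableAt (by simp)).hasFDerivAt
      have h' := hasFDerivAt_swMap 2 A₀
      rw [← swMap_zero (k := 2) A₀] at h
      have h2 := h.comp 0 h'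
      rwa [swMap_zero] at h2
    have h2 : HasFDerivAt (fun G => Ψ (swMap 2 A₀ G)) c 0 := by
      refine c.hasFDerivAt.congr_of_eventuallyEq ?_
      filter_upwards [hswt.eventually hΨg, hleft] with G h3 h4
      rw [h3, h4, hc]
    intro G
    exact congrArg (fun f : Herm (2 + m) →L[ℝ] EuclideanSpace ℝ (Fin 3) => f G) (h1.unique h2)
  refine ⟨?_, hsmooth, hstd, ?_, ?_⟩
  · rw [hΨg.self_of_nhds]
    beta_reduce
    rw [hg0, ← hc, map_zero]
  · intro y
    obtain ⟨G, rfl⟩ := pauliCoord_surjective (m := m) y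
    exact ⟨_, hder G⟩
  · intro v
    constructor
    · rintro ⟨γ, ε, hε, -, hγ, hγ0, hγ'⟩
      have h := (hsmooth.differentiableAt (by simp)).hasFDerivAt
      rw [← hγ0] at h
      have h1 := h.comp_hasDerivAt 0 hγ'
      rw [hγ0] at h1
      have hγt : Filter.Tendsto γ (𝓝 0) (𝓝 A₀) := by
        have := hγ'.continuousAt.tendsto
        rwa [hγ0] at this
      have h2 : Ψ ∘ γ =ᶠ[𝓝 0] fun _ => 0 := by
        filter_upwards [hγt.eventually hmem, Ioo_mem_nhds (neg_lt_zero.2 hε) hε] with t h3 h4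
        exact h3.1 (hγ t h4)
      exact h1.unique
        ((hasDerivAt_const (0 : ℝ) (0 : EuclideanSpace ℝ (Fin 3))).congr_of_eventuallyEq h2)
    · intro hv
      -- The required curve in `Σ₂` is the `swMap` image of the line `t • G`, which stays in the
      -- kernel of `pauliCoord`.
      obtain ⟨G, hG⟩ := (swDerivEquiv h₀ hd).surjective v
      rw [swDerivEquiv_apply] at hG
      have hG0 : pauliCoord G = 0 := by rw [← hder, hG, hv]
      have hlin : ∀ t : ℝ, pauliCoord (t • G) = 0 := fun t => by
        rw [← hc, map_smul, hc, hG0, smul_zero]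
      have hcurve : ContDiff ℝ ∞ fun t : ℝ => t • G := contDiff_id.smul contDiff_const
      have ht : Filter.Tendsto (fun t : ℝ => t • G) (𝓝 0) (𝓝 0) := by
        have := hcurve.continuous.tendsto 0
        rwa [zero_smul] at this
      have hev : ∀ᶠ t : ℝ in 𝓝 0, swMap 2 A₀ (t • G) ∈ SigmaSet 2 (2 + m) := by
        filter_upwards [ht.eventually hgap] with t h
        exact (swMap_mem_SigmaSet_iff h₀ htop h).2 (hlin t)
      obtain ⟨ε, hε, hball⟩ := Metric.eventually_nhds_iff.1 hev
      refine ⟨fun t => swMap 2 A₀ (t • G), ε, hε,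
        ((contDiff_swMap 2 A₀).comp hcurve).contDiffOn, fun t ht => hball ?_, ?_, ?_⟩
      · rw [Real.dist_eq, sub_zero]
        exact abs_lt.2 ht
      · beta_reduce
        rw [zero_smul, swMap_zero]
      · have h1 : HasDerivAt (fun t : ℝ => t • G) G 0 := by
          simpa using (hasDerivAt_id (0 : ℝ)).smul_const G
        have h := hasFDerivAt_swMap 2 A₀
        rw [← zero_smul ℝ G] at h
        have h2 := h.comp_hasDerivAt 0 h1
        rw [← hG]
        exact h2

end Splitting

/-! ### Change of eigenbasis -/

section UnitaryConj

variable {n : ℕ} (U : Matrix.unitaryGroup (Fin n) ℂ)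

theorem unitaryConj_mat (A : Herm n) : (unitaryConj U A).mat = star U.1 * A.mat * U.1 := rfl

/-- Conjugation by a unitary matrix, as a linear map. -/
def unitaryConjₗ : Herm n →ₗ[ℝ] Herm n where
  toFun := unitaryConj U
  map_add' A B := mat_injective (by
    simp only [unitaryConj_mat, mat_add, mul_add, add_mul])
  map_smul' c A := mat_injective (by
    simp only [unitaryConj_mat, mat_smul, RingHom.id_apply, Matrix.mul_smul, Matrix.smul_mul])

theorem unitaryConj_star_unitaryConj (A : Herm n) : unitaryConj (star U) (unitaryConj U A) = A := by
  refine mat_injective ?_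
  rw [unitaryConj_mat, unitaryConj_mat, Unitary.coe_star, star_star]
  have h : U.1 * star U.1 = 1 := Unitary.mul_star_self_of_mem U.2
  rw [mul_assoc, mul_assoc, h, mul_one, ← mul_assoc, h, one_mul]

theorem unitaryConj_unitaryConj_star (A : Herm n) : unitaryConj U (unitaryConj (star U) A) = A := by
  have := unitaryConj_star_unitaryConj (star U) A
  rwa [star_star] at this

theorem eig_unitaryConj (A : Herm n) : eig (unitaryConj U A) = eig A :=
  eig_eq_of_charpoly_eq (charpoly_eq_of_conj (Unitary.star_mul_self_of_mem U.2) rfl)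

theorem stdDevEig_unitaryConj (k : ℕ) (A : Herm n) :
    stdDevEig k (unitaryConj U A) = stdDevEig k A := by
  simp only [stdDevEig, meanEig, eig_unitaryConj]

theorem unitaryConj_mem_SigmaSet {k : ℕ} {A : Herm n} (hA : A ∈ SigmaSet k n) :
    unitaryConj U A ∈ SigmaSet k n := by
  simpa only [SigmaSet, Set.mem_ofPred_eq, eig_unitaryConj] using hA

theorem unitaryConj_mem_tangentVectors {k : ℕ} {A v : Herm n}
    (hv : v ∈ tangentVectors (SigmaSet k n) A) :
    unitaryConj U v ∈ tangentVectors (SigmaSet k n) (unitaryConj U A) := by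
  obtain ⟨c, ε, hε, hc, hmem, hc0, hcv⟩ := hv
  let L : Herm n →L[ℝ] Herm n := (unitaryConjₗ U).toContinuousLinearMap
  refine ⟨fun t => L (c t), ε, hε, L.contDiff.comp_contDiffOn hc,
    fun t ht => unitaryConj_mem_SigmaSet U (hmem t ht), congrArg L hc0, ?_⟩
  exact L.hasFDerivAt.comp_hasDerivAt 0 hcv

theorem unitaryConj_mem_tangentVectors_iff {k : ℕ} {A v : Herm n} :
    unitaryConj U v ∈ tangentVectors (SigmaSet k n) (unitaryConj U A) ↔
      v ∈ tangentVectors (SigmaSet k n) A := by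
  refine ⟨fun h => ?_, unitaryConj_mem_tangentVectors U⟩
  have := unitaryConj_mem_tangentVectors (star U) h
  rwa [unitaryConj_star_unitaryConj, unitaryConj_star_unitaryConj] at this

/-- Conjugation by `U` is a linear automorphism that preserves the sorted spectrum, hence also `Σ₂`,
its tangent vectors and the splitting. -/
theorem IsSplittingMap.comp_unitaryConj {Ψ : Herm n → EuclideanSpace ℝ (Fin 3)} {A : Herm n}
    (h : IsSplittingMap Ψ (unitaryConj U A)) : IsSplittingMap (fun B => Ψ (unitaryConj U B)) A := by
  let L : Herm n →L[ℝ] Herm n := (unitaryConjₗ U).toContinuousLinearMap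
  have hder : ∀ v, fderiv ℝ (fun B => Ψ (unitaryConj U B)) A v =
      fderiv ℝ Ψ (unitaryConj U A) (unitaryConj U v) := by
    have h1 : HasFDerivAt Ψ (fderiv ℝ Ψ (unitaryConj U A)) (L A) :=
      (h.contDiffAt.differentiableAt (by simp)).hasFDerivAt
    have h2 := (h1.comp A L.hasFDerivAt).fderiv
    intro v
    exact congrArg (fun f : Herm n →L[ℝ] EuclideanSpace ℝ (Fin 3) => f v) h2
  refine ⟨h.map_base, ?_, ?_, ?_, ?_⟩
  · exact ContDiffAt.comp A (g := Ψ) (f := L) h.contDiffAt L.contDiff.contDiffAt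
  · have ht : Filter.Tendsto (unitaryConj U) (𝓝 A) (𝓝 (unitaryConj U A)) := L.continuous.tendsto A
    filter_upwards [ht.eventually h.stdDevEig_eq] with B hB
    rw [← hB, stdDevEig_unitaryConj]
  · intro y
    obtain ⟨v, rfl⟩ := h.fderiv_surjective y
    exact ⟨unitaryConj (star U) v, by rw [hder, unitaryConj_unitaryConj_star]⟩
  · intro v
    rw [hder, ← h.mem_tangentVectors_iff, unitaryConj_mem_tangentVectors_iff]

theorem isSplittingMap_of_diagonalizes {A : Herm n} (hA : A ∈ SigmaSet 2 n)
    (hU : Diagonalizes U A) :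
    IsSplittingMap (fun B => pauliCoord
      (effectiveHamiltonian 2 (unitaryConj U A) (unitaryConj U B))) A := by
  obtain ⟨hn, heq, hlt⟩ := hA
  obtain ⟨m, rfl⟩ := Nat.exists_eq_add_of_le hn
  have hμ : ∃ μ : ℝ, (∀ a : Fin (2 + m), (a : ℕ) < 2 → eig A a < μ) ∧
      ∀ a : Fin (2 + m), 2 ≤ (a : ℕ) → μ < eig A a := by
    -- For `n = 2` there are no higher levels and any `μ` above the ground energy works; otherwise
    -- `μ` is the midpoint of the gap.
    rcases Nat.eq_zero_or_pos m with rfl | hm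
    · refine ⟨eig A 0 + 1, fun a ha => ?_, fun a ha => absurd a.2 (by omega)⟩
      rw [heq a 0 ha (by simp)]
      linarith
    · let b : Fin (2 + m) := Fin.natAdd 2 ⟨0, hm⟩
      let c : Fin (2 + m) := Fin.castAdd m 0
      have hcb := hlt c b (by simp [c]) (by simp [b])
      refine ⟨(eig A c + eig A b) / 2, fun a ha => ?_, fun a ha => ?_⟩
      · rw [heq a c ha (by simp [c])]
        linarith
      · have : eig A b ≤ eig A a := eig_monotone A (Fin.le_def.2 (by simpa [b] using ha))
        linarith
  obtain ⟨μ, hlo, hhi⟩ := hμ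
  exact (isSplittingMap_effectiveHamiltonian hU hlo hhi
    (heq _ _ (by simp) (by simp))).comp_unitaryConj U

end UnitaryConj

/-! ### Order of vanishing along `t > 0` -/

section Order

variable {E : Type*} [NormedAddCommGroup E] [NormedSpace ℝ E]

theorem isBigO_sq_of_deriv_eq_zero {g : ℝ → E} (hg : ContDiffAt ℝ 2 g 0) (hg0 : g 0 = 0)
    (hg' : deriv g 0 = 0) : g =O[𝓝[>] (0 : ℝ)] fun t => t ^ 2 := by
  obtain ⟨u, hu, hgu⟩ := hg.contDiffOn le_rfl (by simp)
  obtain ⟨ε, hε, hball⟩ := Metric.mem_nhds_iff.1 hu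
  have hsub : Set.Icc 0 (ε / 2) ⊆ u := fun t ht => hball (by
    rw [Metric.mem_ball, Real.dist_eq, sub_zero, abs_of_nonneg ht.1]; linarith [ht.2])
  obtain ⟨C, hC⟩ := exists_taylor_mean_remainder_bound (n := 1) (by linarith : (0 : ℝ) ≤ ε / 2)
    (hgu.mono hsub)
  refine Asymptotics.IsBigO.of_bound C ?_
  filter_upwards [Ioc_mem_nhdsGT (by linarith : (0 : ℝ) < ε / 2)] with t ht
  have h := hC t ⟨ht.1.le, ht.2⟩
  have hd : derivWithin g (Set.Icc 0 (ε / 2)) 0 = 0 := by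
    rw [(hg.differentiableAt (by simp)).derivWithin
      (uniqueDiffOn_Icc (by linarith) _ ⟨le_rfl, by linarith⟩), hg']
  rw [taylorWithinEval_succ, taylor_within_zero_eval, hg0, iteratedDerivWithin_one, hd] at h
  simpa using h

/-- The bound controls only the derivative from the right, but this determines the two-sided one,
which exists by hypothesis. -/
theorem deriv_eq_zero_of_isBigO_sq {g : ℝ → E} (hg : DifferentiableAt ℝ g 0) (hg0 : g 0 = 0)
    (h : g =O[𝓝[>] (0 : ℝ)] fun t => t ^ 2) : deriv g 0 = 0 := by
  have h1 : HasDerivWithinAt g 0 (Set.Ioi 0) 0 := by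
    rw [hasDerivWithinAt_iff_isLittleO]
    simp only [hg0, sub_zero, smul_zero]
    refine h.trans_isLittleO ?_
    have : (fun t : ℝ => t ^ 2) =o[𝓝 0] fun t : ℝ => t := by
      simpa using Asymptotics.isLittleO_pow_id (𝕜 := ℝ) one_lt_two
    exact this.mono nhdsWithin_le_nhds
  exact (uniqueDiffWithinAt_Ioi 0).eq_deriv _ hg.hasDerivAt.hasDerivWithinAt h1

/-- The norm destroys smoothness of `f`, so orders are compared for `g`: order at least 1 is
automatic, and order at least 2 means a vanishing derivative. -/
theorem ordZero_eq_one_iff {f : ℝ → ℝ} {g : ℝ → E} {c : ℝ} (hc : 0 < c)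
    (hg : ContDiffAt ℝ 2 g 0) (hg0 : g 0 = 0) (hfg : ∀ᶠ t in 𝓝 0, f t = ‖g t‖ / c) :
    ordZero f = 1 ↔ deriv g 0 ≠ 0 := by
  have hO : ∀ r : ℕ, (f =O[𝓝[>] (0 : ℝ)] fun t => t ^ r) ↔
      g =O[𝓝[>] (0 : ℝ)] fun t => t ^ r := by
    intro r
    have h1 : f =ᶠ[𝓝[>] 0] fun t => c⁻¹ * ‖g t‖ := by
      filter_upwards [hfg.filter_mono nhdsWithin_le_nhds] with t ht
      rw [ht, div_eq_inv_mul]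
    rw [Asymptotics.isBigO_congr h1 Filter.EventuallyEq.rfl,
      Asymptotics.isBigO_const_mul_left_iff (inv_ne_zero hc.ne'), Asymptotics.isBigO_norm_left]
  have hdiff : DifferentiableAt ℝ g 0 := hg.differentiableAt (by simp)
  constructor
  · intro h h0
    have h2 : ((2 : ℕ) : ℕ∞) ≤ ordZero f :=
      le_iSup₂ (f := fun (r : ℕ) (_ : f =O[𝓝[>] (0 : ℝ)] fun t => t ^ r) => (r : ℕ∞)) 2
        ((hO 2).2 (isBigO_sq_of_deriv_eq_zero hg hg0 h0))
    rw [h] at h2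
    exact absurd h2 (by norm_num)
  · intro h
    refine le_antisymm (iSup₂_le fun r hr => ?_) ?_
    · by_contra hlt
      have hr2 : 2 ≤ r := by
        by_contra hr2
        apply hlt
        have : r ≤ 1 := by omega
        exact_mod_cast this
      refine h (deriv_eq_zero_of_isBigO_sq hdiff hg0 (((hO r).1 hr).trans ?_))
      refine Asymptotics.IsBigO.of_bound 1 ?_
      filter_upwards [Ioc_mem_nhdsGT (zero_lt_one : (0 : ℝ) < 1)] with t ht
      rw [one_mul, norm_pow, norm_pow, Real.norm_of_nonneg ht.1.le]
      exact pow_le_pow_of_le_one ht.1.le ht.2 hr2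
    · refine le_iSup₂_of_le (f := fun (r : ℕ) (_ : f =O[𝓝[>] (0 : ℝ)] fun t => t ^ r) => (r : ℕ∞))
        1 ((hO 1).2 ?_) (by simp)
      have := hdiff.hasDerivAt.isBigO_sub
      simp only [hg0, sub_zero] at this
      simpa using this.mono nhdsWithin_le_nhds

end Order

/-! ### Derivatives and regular curves in a chart -/

section Chart

variable {m : ℕ} {M : Type*} [TopologicalSpace M] [ChartedSpace (EuclideanSpace ℝ (Fin m)) M]
  {φ : OpenPartialHomeomorph M (EuclideanSpace ℝ (Fin m))} {p : M}

theorem mfderiv_chart_bijective (hφ : φ ∈ IsManifold.maximalAtlas (𝓡 m) ∞ M) (hp : p ∈ φ.source) :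
    Function.Bijective (mfderiv (𝓡 m) (𝓡 m) φ p) :=
  OpenPartialHomeomorph.MDifferentiable.mfderiv_bijective
    ⟨(contMDiffOn_of_mem_maximalAtlas hφ).mdifferentiableOn (by simp),
      (contMDiffOn_symm_of_mem_maximalAtlas hφ).mdifferentiableOn (by simp)⟩ hp

theorem contDiffAt_comp_chart_symm {E : Type*} [NormedAddCommGroup E] [NormedSpace ℝ E]
    {H : M → E} (hH : ContMDiff (𝓡 m) 𝓘(ℝ, E) ∞ H)
    (hφ : φ ∈ IsManifold.maximalAtlas (𝓡 m) ∞ M) (hp : p ∈ φ.source) :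
    ContDiffAt ℝ ∞ (fun x => H (φ.symm x)) (φ p) := by
  rw [← contMDiffAt_iff_contDiffAt]
  exact hH.contMDiffAt.comp (φ p)
    (contMDiffAt_symm_of_mem_maximalAtlas hφ (φ.map_source hp))

theorem mfderiv_eq_fderiv_comp_chart_symm {E : Type*} [NormedAddCommGroup E] [NormedSpace ℝ E]
    {H : M → E} (hH : ContMDiff (𝓡 m) 𝓘(ℝ, E) ∞ H)
    (hφ : φ ∈ IsManifold.maximalAtlas (𝓡 m) ∞ M) (hp : p ∈ φ.source) (u : TangentSpace (𝓡 m) p) :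
    (mfderiv (𝓡 m) 𝓘(ℝ, E) H p u : E) =
      fderiv ℝ (fun x => H (φ.symm x)) (φ p) (mfderiv (𝓡 m) (𝓡 m) φ p u) := by
  have h1 : MDifferentiableAt (𝓡 m) (𝓡 m) φ p :=
    (contMDiffAt_of_mem_maximalAtlas hφ hp).mdifferentiableAt (by simp)
  have h2 : MDifferentiableAt (𝓡 m) 𝓘(ℝ, E) (fun x => H (φ.symm x)) (φ p) :=
    ((contDiffAt_comp_chart_symm hH hφ hp).differentiableAt (by simp)).mdifferentiableAt
  have h := mfderiv_comp p h2 h1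
  have h3 : (fun x => H (φ.symm x)) ∘ φ =ᶠ[𝓝 p] H := by
    filter_upwards [φ.eventually_left_inverse hp] with q hq
    exact congrArg H hq
  rw [h3.mfderiv_eq] at h
  have h4 := congrArg (fun f => f u) h
  rw [mfderiv_eq_fderiv] at h4
  exact h4

theorem IsRegularCurveAt.contMDiffAt {γ : ℝ → M} (hγ : IsRegularCurveAt (m := m) γ p) :
    ContMDiffAt 𝓘(ℝ, ℝ) (𝓡 m) ∞ γ 0 := by
  obtain ⟨-, ⟨ε, hε, h⟩, -⟩ := hγ
  exact h.contMDiffAt (Ioo_mem_nhds (neg_lt_zero.2 hε) hε)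

theorem IsRegularCurveAt.contDiffAt_chart {γ : ℝ → M} (hγ : IsRegularCurveAt (m := m) γ p)
    (hφ : φ ∈ IsManifold.maximalAtlas (𝓡 m) ∞ M) (hp : p ∈ φ.source) :
    ContDiffAt ℝ ∞ (fun t => φ (γ t)) 0 := by
  rw [← contMDiffAt_iff_contDiffAt]
  have h : ContMDiffAt (𝓡 m) (𝓡 m) ∞ φ (γ 0) := by
    rw [hγ.1]; exact contMDiffAt_of_mem_maximalAtlas hφ hp
  exact h.comp 0 hγ.contMDiffAt

theorem deriv_chart_comp {γ : ℝ → M} (hγ0 : γ 0 = p)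
    (hγ : MDifferentiableAt 𝓘(ℝ, ℝ) (𝓡 m) γ 0)
    (hφ : φ ∈ IsManifold.maximalAtlas (𝓡 m) ∞ M) (hp : p ∈ φ.source) :
    deriv (fun t => φ (γ t)) 0 =
      mfderiv (𝓡 m) (𝓡 m) φ (γ 0) (mfderiv 𝓘(ℝ, ℝ) (𝓡 m) γ 0 (1 : ℝ)) := by
  subst hγ0
  have h1 : MDifferentiableAt (𝓡 m) (𝓡 m) φ (γ 0) :=
    (contMDiffAt_of_mem_maximalAtlas hφ hp).mdifferentiableAt (by simp)
  have h := mfderiv_comp (0 : ℝ) h1 hγ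
  rw [mfderiv_eq_fderiv] at h
  have h4 := congrArg (fun f => f (1 : ℝ)) h
  rw [← fderiv_apply_one_eq_deriv]
  exact h4

theorem IsRegularCurveAt.deriv_chart_ne_zero {γ : ℝ → M} (hγ : IsRegularCurveAt (m := m) γ p)
    (hφ : φ ∈ IsManifold.maximalAtlas (𝓡 m) ∞ M) (hp : p ∈ φ.source) :
    deriv (fun t => φ (γ t)) 0 ≠ 0 := by
  rw [deriv_chart_comp hγ.1 (hγ.contMDiffAt.mdifferentiableAt (by simp)) hφ hp]
  have hp' : γ 0 ∈ φ.source := by rwa [hγ.1]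
  intro h
  exact hγ.2.2 ((mfderiv_chart_bijective hφ hp').1 (h.trans (map_zero _).symm))

theorem exists_isRegularCurveAt (hφ : φ ∈ IsManifold.maximalAtlas (𝓡 m) ∞ M) (hp : p ∈ φ.source)
    {u : EuclideanSpace ℝ (Fin m)} (hu : u ≠ 0) :
    ∃ γ : ℝ → M, IsRegularCurveAt (m := m) γ p ∧ deriv (fun t => φ (γ t)) 0 = u := by
  -- A straight line in the chart realizes the prescribed velocity.
  let c : ℝ → EuclideanSpace ℝ (Fin m) := fun t => φ p + t • u
  have hc : ContDiff ℝ ∞ c := contDiff_const.add (contDiff_id.smul contDiff_const)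
  have hc0 : c 0 = φ p := by simp [c]
  have hct : ∀ᶠ t in 𝓝 0, c t ∈ φ.target :=
    hc.continuous.continuousAt.eventually (by
      rw [hc0]; exact φ.open_target.mem_nhds (φ.map_source hp))
  have hderiv : deriv (fun t => φ (φ.symm (c t))) 0 = u := by
    have h1 : (fun t => φ (φ.symm (c t))) =ᶠ[𝓝 0] c := by
      filter_upwards [hct] with t ht using φ.right_inv ht
    have h2 : HasDerivAt c u 0 := by
      simpa [c] using ((hasDerivAt_id (0 : ℝ)).smul_const u).const_add (φ p)
    rw [h1.deriv_eq, h2.deriv]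
  have h0 : φ.symm (c 0) = p := by rw [hc0, φ.left_inv hp]
  obtain ⟨ε, hε, hball⟩ := Metric.eventually_nhds_iff.1 hct
  have hsmooth : ContMDiffOn 𝓘(ℝ, ℝ) (𝓡 m) ∞ (fun t => φ.symm (c t)) (Set.Ioo (-ε) ε) := by
    refine (contMDiffOn_symm_of_mem_maximalAtlas hφ).comp hc.contMDiff.contMDiffOn fun t ht => ?_
    refine hball ?_
    rw [Real.dist_eq, sub_zero]
    exact abs_lt.2 ht
  refine ⟨fun t => φ.symm (c t), ⟨h0, ⟨ε, hε, hsmooth⟩, fun hz => hu ?_⟩, hderiv⟩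
  have hd := (hsmooth.contMDiffAt (Ioo_mem_nhds (neg_lt_zero.2 hε) hε)).mdifferentiableAt
    (by simp)
  rw [← hderiv, deriv_chart_comp h0 hd hφ hp, hz]
  exact map_zero _

end Chart

/-! ### The equivalences -/

theorem finrank_range_eq_iff_surjective {m : ℕ}
    (f : EuclideanSpace ℝ (Fin m) →ₗ[ℝ] EuclideanSpace ℝ (Fin m)) :
    Module.finrank ℝ (LinearMap.range f) = m ↔ Function.Surjective f := by
  rw [← LinearMap.range_eq_top]
  constructor
  · intro h
    exact Submodule.eq_top_of_finrank_eq (by rw [h]; simp)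
  · intro h
    rw [h]; simp

theorem mainTheorem6 {M : Type*} [TopologicalSpace M] [ChartedSpace (EuclideanSpace ℝ (Fin 3)) M]
    [IsManifold (𝓡 3) ∞ M] {n : ℕ}
    (H : M → Herm n) (hH : ContMDiff (𝓡 3) 𝓘(ℝ, Herm n) ∞ H)
    (p₀ : M) (hp₀ : H p₀ ∈ SigmaSet 2 n)
    (U₀ : Matrix.unitaryGroup (Fin n) ℂ) (hU₀ : Diagonalizes U₀ (H p₀))
    (φ : OpenPartialHomeomorph M (EuclideanSpace ℝ (Fin 3)))
    (hφ : φ ∈ IsManifold.maximalAtlas (𝓡 3) ∞ M) (hφp₀ : p₀ ∈ φ.source) (hφ0 : φ p₀ = 0) :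
    effectiveMap H p₀ U₀ φ 0 = 0 ∧
    ContDiffAt ℝ ∞ (effectiveMap H p₀ U₀ φ) 0 ∧
    List.TFAE [
      IsTransverseAt (m := 3) H (SigmaSet 2 n) p₀,
      Module.finrank ℝ (LinearMap.range (fderiv ℝ (effectiveMap H p₀ U₀ φ) 0).toLinearMap) = 3,
      ∀ γ : ℝ → M, IsRegularCurveAt (m := 3) γ p₀ →
        deriv (fun t => effectiveMap H p₀ U₀ φ (φ (γ t))) 0 ≠ 0,
      ∀ γ : ℝ → M, IsRegularCurveAt (m := 3) γ p₀ →
        splittingOrder 2 (fun t => H (γ t)) = 1] := by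
  have hΨ := isSplittingMap_of_diagonalizes U₀ hp₀ hU₀
  set Ψ : Herm n → EuclideanSpace ℝ (Fin 3) := fun B => pauliCoord
      (effectiveHamiltonian 2 (unitaryConj U₀ (H p₀)) (unitaryConj U₀ B)) with hΨdef
  set h := effectiveMap H p₀ U₀ φ with hh
  have hhΨ : ∀ x, h x = Ψ (H (φ.symm x)) := fun _ => rfl
  have hsymm0 : φ.symm 0 = p₀ := by rw [← hφ0, φ.left_inv hφp₀]
  have hf : ContDiffAt ℝ ∞ (fun x => H (φ.symm x)) 0 := by
    have := contDiffAt_comp_chart_symm hH hφ hφp₀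
    rwa [hφ0] at this
  have hΨ' : ContDiffAt ℝ ∞ Ψ (H (φ.symm 0)) := by rw [hsymm0]; exact hΨ.contDiffAt
  have hh0 : h 0 = 0 := by rw [hhΨ, hsymm0]; exact hΨ.map_base
  have hhs : ContDiffAt ℝ ∞ h 0 := ContDiffAt.comp (g := Ψ) (0 : EuclideanSpace ℝ (Fin 3)) hΨ' hf
  have hdh : ∀ u : TangentSpace (𝓡 3) p₀,
      fderiv ℝ Ψ (H p₀) (show Herm n from mfderiv (𝓡 3) 𝓘(ℝ, Herm n) H p₀ u) =
        fderiv ℝ h 0 (mfderiv (𝓡 3) (𝓡 3) φ p₀ u) := by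
    intro u
    have h1 := fderiv_comp (0 : EuclideanSpace ℝ (Fin 3)) (hΨ'.differentiableAt (by simp))
      (hf.differentiableAt (by simp))
    have h2 : fderiv ℝ h 0 = (fderiv ℝ Ψ (H p₀)).comp (fderiv ℝ (fun x => H (φ.symm x)) 0) := by
      rw [hsymm0] at h1
      exact h1
    have h3 := mfderiv_eq_fderiv_comp_chart_symm hH hφ hφp₀ u
    rw [hφ0] at h3
    rw [h2]
    exact congrArg (fderiv ℝ Ψ (H p₀)) h3
  have hbij := mfderiv_chart_bijective hφ hφp₀
  have hcurve : ∀ γ : ℝ → M, IsRegularCurveAt (m := 3) γ p₀ →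
      ContDiffAt ℝ ∞ (fun t => h (φ (γ t))) 0 ∧
      deriv (fun t => h (φ (γ t))) 0 = fderiv ℝ h 0 (deriv (fun t => φ (γ t)) 0) := by
    intro γ hγ
    have h1 := hγ.contDiffAt_chart hφ hφp₀
    have h2 : ContDiffAt ℝ ∞ h (φ (γ 0)) := by rw [hγ.1, hφ0]; exact hhs
    refine ⟨ContDiffAt.comp (g := h) (0 : ℝ) h2 h1, ?_⟩
    have h3 := (h2.differentiableAt (by simp)).hasFDerivAt.comp_hasDerivAt (0 : ℝ)
      (h1.differentiableAt (by simp)).hasDerivAt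
    rw [hγ.1, hφ0] at h3
    exact h3.deriv
  refine ⟨hh0, hhs, ?_⟩
  -- This is where the dimension 3 of `M` matters: it equals the codimension of `Σ₂`.
  have hinj : Function.Surjective (fderiv ℝ h 0) ↔ ∀ u, u ≠ 0 → fderiv ℝ h 0 u ≠ 0 := by
    have h1 := LinearMap.injective_iff_surjective (f := (fderiv ℝ h 0).toLinearMap)
    refine h1.symm.trans ?_
    rw [injective_iff_map_eq_zero]
    exact ⟨fun h u hu h0 => hu (h u h0), fun h u h0 => by_contra fun hu => h u hu h0⟩
  tfae_have 1 ↔ 2 := by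
    rw [finrank_range_eq_iff_surjective]
    constructor
    · intro ht y
      obtain ⟨w, rfl⟩ := hΨ.fderiv_surjective y
      obtain ⟨v, hv, u, hvu⟩ := ht w
      refine ⟨mfderiv (𝓡 3) (𝓡 3) φ p₀ u, ?_⟩
      rw [← hvu, map_add, (hΨ.mem_tangentVectors_iff v).1 hv, zero_add]
      exact (hdh u).symm
    · intro hs w
      obtain ⟨x, hx⟩ := hs (fderiv ℝ Ψ (H p₀) w)
      obtain ⟨u, rfl⟩ := hbij.2 x
      -- With `u` chosen so that `dH u` and `w` have the same image under `dΨ`, their difference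
      -- lies in `ker dΨ`, the tangent space of `Σ₂`.
      refine ⟨w - (show Herm n from mfderiv (𝓡 3) 𝓘(ℝ, Herm n) H p₀ u), ?_, u,
        sub_add_cancel _ _⟩
      rw [hΨ.mem_tangentVectors_iff, map_sub, hdh u, sub_eq_zero]
      exact hx.symm
  tfae_have 2 ↔ 3 := by
    rw [finrank_range_eq_iff_surjective]
    refine hinj.trans ⟨fun hi γ hγ => ?_, fun hi u hu => ?_⟩
    · rw [(hcurve γ hγ).2]
      exact hi _ (hγ.deriv_chart_ne_zero hφ hφp₀)
    · obtain ⟨γ, hγ, hγu⟩ := exists_isRegularCurveAt hφ hφp₀ hu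
      have := hi γ hγ
      rwa [(hcurve γ hγ).2, hγu] at this
  tfae_have 3 ↔ 4 := by
    refine forall₂_congr fun γ hγ => ?_
    refine (ordZero_eq_one_iff (c := √2) (by positivity) ((hcurve γ hγ).1.of_le ?_) ?_ ?_).symm
    · exact WithTop.coe_le_coe.2 le_top
    · rw [hγ.1, hφ0, hh0]
    · have hγc : Filter.Tendsto γ (𝓝 0) (𝓝 p₀) := by
        have := hγ.contMDiffAt.continuousAt.tendsto
        rwa [hγ.1] at this
      filter_upwards [hγc.eventually (φ.eventually_left_inverse hφp₀),
        (hH.continuous.continuousAt.tendsto.comp hγc).eventually hΨ.stdDevEig_eq] with t h1 h2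
      rw [hhΨ, h1]
      exact h2
  tfae_finish
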